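/- \textbf{Theorem (Sharp bounds).} Let $F_1,F_2$ be arbitrary distribution functions on $\mathbb{R}$, let $d\ge 1$ be an integer, and let $G_2$ be the distribution function of $X_2^d$ when $X_2\sim F_2$. Write $F^{-1}(p)=\inf\{x:F(x)\ge p\}$. Let $U,V$ be independent random variables, uniform on $[0,1]$, on a probability space on which all random variables below are defined. Put $$M=\mathbb{E}\big(F_1^{-1}(U)\,G_2^{-1}(U)\big),\qquad m=\mathbb{E}\big(F_1^{-1}(1-U)\,G_2^{-1}(U)\big).$$ If the expectation $M$ (respectively $m$) exists and is finite, then the positive (respectively negative) part of $X_1X_2^d$ is integrable whenever $X_1\sim F_1$, $X_2\sim F_2$, and $M$ is the supremum (respectively $m$ is the infimum) of $\mathbb{E}(X_1X_2^d)$ over all pairs with $X_1\sim F_1$, $X_2\sim F_2$ and $X_1X_2^d$ integrable; the supremum (respectively infimum) is attained. It is attained by $X_i=F_i^{-1}(U_i)$, $i=1,2$, with $U_1,U_2$ uniform on $[0,1]$, where $U_1=U$ for $M$ and $U_1=1-U$ for $m$, and $U_2$ is as follows. If $d$ is odd, $U_2=U$. If $d$ is even, let $\underline{x}_2=\inf\{x:F_2(x)>0\}\in[-\infty,\infty)$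 and $\bar{x}_2=\sup\{x:F_2(x)<1\}\in(-\infty,\infty]$, with $F_2(-\infty)=0$, $F_2(+\infty)=1$. Let $g(x)=x-F_2(-F_2^{-1}(x))$ for $x\in(0,1)$ (this is strictly increasing), $f=-g$, let $g^{-1},f^{-1}$ be their inverse functions, and let $$J=\mathbf{1}_{\{V>p(U)\}},\qquad p(u)=\frac{|g'(g^{-1}(u))|}{|f'(f^{-1}(u))|+|g'(g^{-1}(u))|}.$$ (1) Let $\underline{x}_2\le 0<\bar{x}_2$, $|\underline{x}_2|\le\bar{x}_2$ and $c=F_2(-\underline{x}_2)$. Then $U_2=(1-I)\big[J\,g^{-1}(U)+(1-J)\,f^{-1}(U)\big]+I\,U$ with $I=\mathbf{1}_{\{U>c\}}$. (2) Let $\underline{x}_2<0\le\bar{x}_2$, $|\underline{x}_2|\ge\bar{x}_2$ and $c=1-F_2(-\bar{x}_2)$. Then $U_2=(1-K)\big[J\,g^{-1}(U)+(1-J)\,f^{-1}(U)\big]+K\,(1-U)$ with $K=\mathbf{1}_{\{U>c\}}$. In (1) and (2) it is understood that the functions in the formula exist, that is, for almost every $u\in(0,c)$, $u$ belongs to the ranges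 of $g$ and $f$, $g$ is differentiable at $g^{-1}(u)$, and $f$ is differentiable at $f^{-1}(u)$. -/

import Mathlib

open MeasureTheory ProbabilityTheory Set

namespace SharpBounds

noncomputable section

/-- The uniform law on `[0,1]`. -/
def unif : Measure ℝ := volume.restrict (Icc (0 : ℝ) 1)

/-- The generalized quantile function `F⁻¹(p) = inf {x : F(x) ≥ p}`, where `F` is the CDF of `μ`.
It is only used for `p` in `(0,1)`, up to null sets. -/
def quantile (μ : Measure ℝ) (p : ℝ) : ℝ := sInf {x : ℝ | p ≤ cdf μ x}

/-- The law of `X ^ d` when `X` has law `μ`. -/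
def powLaw (μ : Measure ℝ) (d : ℕ) : Measure ℝ := μ.map (fun x : ℝ => x ^ d)

/-- The left endpoint of the domain of the CDF of `μ`, possibly `-∞`. -/
def lowerEnd (μ : Measure ℝ) : EReal := sInf ((fun x : ℝ => (x : EReal)) '' {x : ℝ | 0 < cdf μ x})

/-- The right endpoint of the domain of the CDF of `μ`, possibly `+∞`. -/
def upperEnd (μ : Measure ℝ) : EReal := sSup ((fun x : ℝ => (x : EReal)) '' {x : ℝ | cdf μ x < 1})

/-- The CDF of `μ` extended to `[-∞, +∞]`, so that `F(-∞) = 0` and `F(+∞) = 1`. -/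
def cdfExt (μ : Measure ℝ) (x : EReal) : ℝ := μ.real {y : ℝ | (y : EReal) ≤ x}

/-- `g(x) = x - F(-F⁻¹(x))`. -/
def g (μ : Measure ℝ) (x : ℝ) : ℝ := x - cdf μ (-quantile μ x)

/-- `f(x) = -g(x)`. -/
def f (μ : Measure ℝ) (x : ℝ) : ℝ := -g μ x

/-- The inverse function of `g` on `(0,1)`, where `g` is strictly increasing. -/
def gInv (μ : Measure ℝ) (u : ℝ) : ℝ := Function.invFunOn (g μ) (Ioo 0 1) u

/-- The inverse function of `f` on `(0,1)`, where `f` is strictly decreasing. -/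
def fInv (μ : Measure ℝ) (u : ℝ) : ℝ := Function.invFunOn (f μ) (Ioo 0 1) u

/-- The threshold `|g'| / (|f'| + |g'|)`, each derivative being taken on its own branch, that is,
`g'` at `g⁻¹(u)` and `f'` at `f⁻¹(u)`. -/
def threshold (μ : Measure ℝ) (u : ℝ) : ℝ :=
  |deriv (g μ) (gInv μ u)| / (|deriv (f μ) (fInv μ u)| + |deriv (g μ) (gInv μ u)|)

/-- The indicator `J` of `V > |g'| / (|f'| + |g'|)`. -/
def J (μ : Measure ℝ) (u v : ℝ) : ℝ := if threshold μ u < v then 1 else 0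

/-- The level `F(-x̲)` at which the indicator `I` switches. -/
def levelI (μ : Measure ℝ) : ℝ := cdfExt μ (-lowerEnd μ)

/-- The level `1 - F(-x̄)` at which the indicator `K` switches. -/
def levelK (μ : Measure ℝ) : ℝ := 1 - cdfExt μ (-upperEnd μ)

/-- The indicator `I` of `U > F(-x̲)`. -/
def I (μ : Measure ℝ) (u : ℝ) : ℝ := if levelI μ < u then 1 else 0

/-- The indicator `K` of `U > 1 - F(-x̄)`. -/
def K (μ : Measure ℝ) (u : ℝ) : ℝ := if levelK μ < u then 1 else 0

/-- `U₂` for even `d` when `|x̲| ≤ x̄`. -/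
def evenCaseI (μ : Measure ℝ) (u v : ℝ) : ℝ :=
  (1 - I μ u) * (J μ u v * gInv μ u + (1 - J μ u v) * fInv μ u) + I μ u * u

/-- `U₂` for even `d` when `|x̲| ≥ x̄`. -/
def evenCaseK (μ : Measure ℝ) (u v : ℝ) : ℝ :=
  (1 - K μ u) * (J μ u v * gInv μ u + (1 - J μ u v) * fInv μ u) + K μ u * (1 - u)

/-- The objects used below the level `c` exist: for almost every `u` in `(0,c)`, the inverse
functions of `g` and `f` are defined at `u`, and `g`, `f` are differentiable there. -/
def InverseBranches (μ : Measure ℝ) (c : ℝ) : Prop :=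
  ∀ᵐ u ∂(volume.restrict (Ioo (0 : ℝ) c)),
    (u ∈ g μ '' Ioo 0 1 ∧ DifferentiableAt ℝ (g μ) (gInv μ u)) ∧
    (u ∈ f μ '' Ioo 0 1 ∧ DifferentiableAt ℝ (f μ) (fInv μ u))

variable {Ω : Type*} [MeasurableSpace Ω]

/-- All finite values `E(X₁ X₂ ^ d)` with `X₁ ∼ μ₁` and `X₂ ∼ μ₂` on the given space. -/
def mixedMoments (P : Measure Ω) (μ₁ μ₂ : Measure ℝ) (d : ℕ) : Set ℝ :=
  {e : ℝ | ∃ X₁ X₂ : Ω → ℝ, HasLaw X₁ μ₁ P ∧ HasLaw X₂ μ₂ P ∧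
    Integrable (fun ω => X₁ ω * X₂ ω ^ d) P ∧ e = ∫ ω, X₁ ω * X₂ ω ^ d ∂P}

/-- The value `e` of `E(X₁ X₂ ^ d)` is obtained when `Xᵢ = Fᵢ⁻¹(Uᵢ)`: both `Uᵢ` are uniform, the
`Xᵢ` have the prescribed laws, and `E(X₁ X₂ ^ d)` is finite and equal to `e`. -/
structure Attains (P : Measure Ω) (μ₁ μ₂ : Measure ℝ) (d : ℕ) (U₁ U₂ : Ω → ℝ) (e : ℝ) : Prop where
  unif₁ : HasLaw U₁ unif P
  unif₂ : HasLaw U₂ unif P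
  law₁ : HasLaw (fun ω => quantile μ₁ (U₁ ω)) μ₁ P
  law₂ : HasLaw (fun ω => quantile μ₂ (U₂ ω)) μ₂ P
  integrable : Integrable (fun ω => quantile μ₁ (U₁ ω) * quantile μ₂ (U₂ ω) ^ d) P
  eq : ∫ ω, quantile μ₁ (U₁ ω) * quantile μ₂ (U₂ ω) ^ d ∂P = e

end

end SharpBounds

open SharpBounds

/-! The bounds rest on rearrangement. Split the positive part of `XY` into `X⁺Y⁺ + X⁻Y⁻` and the
negative part into `X⁺Y⁻ + X⁻Y⁺`, and write each term as a double integral of quadrant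
probabilities. With the marginals fixed, a comonotone pair attains the Fréchet upper bound on the
first kind of quadrant and the lower bound on the second. It therefore maximises the positive part
and minimises the negative part separately (`Comonotone.lintegral_ofReal_le`,
`Comonotone.le_lintegral_ofReal_neg`). Applied to `±X₁` and `X₂ ^ d`, this gives the bounds, and any
two comonotone couplings with the same marginals have the same mean.

Attainment for every `d` lifts the quantile of the law of `X₂ ^ d` to a random variable `X₂`, using
`V` to sample the conditional law (`exists_hasLaw_comp_ae_eq`).

The explicit `U₂` must be uniform and make `X₂ ^ d` increasing in `U`. For odd `d`, `U₂ = U` does.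
For even `d`, `|X₂|` must increase with `U`. The branches `v = g⁻¹(u)` and `w = f⁻¹(u)` give a
positive and a negative value of `X₂`; their absolute values interlace as `u` grows, so either may
be chosen. Moreover `v - w = u` (`gInv_sub_fInv`), and differentiating gives `1/|g'| + 1/|f'| = 1`.
The selection probabilities given by `J` are thus the Jacobians of the two branches, and the change
of variables in `lintegral_branches` makes `U₂` uniform. -/

namespace SharpBounds

/-! ### Rearrangement inequality for comonotone pairs -/

section Comonotone

open scoped ENNReal

variable {Ω : Type*} [MeasurableSpace Ω] {P : Measure Ω}

/-- Layer-cake formula twice: first for `X` under the measure with density `Y⁺`, then for `Y` on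
each event `{s < X}`. -/
theorem lintegral_ofReal_mul_ofReal_of_measurable [SFinite P] {X Y : Ω → ℝ} (hX : Measurable X)
    (hY : Measurable Y) :
    ∫⁻ ω, ENNReal.ofReal (X ω) * ENNReal.ofReal (Y ω) ∂P =
      ∫⁻ s in Ioi (0 : ℝ), ∫⁻ t in Ioi (0 : ℝ), P {ω | s < X ω ∧ t < Y ω} := by
  have pos : ∀ (Q : Measure Ω) {Z : Ω → ℝ}, Measurable Z →
      ∫⁻ ω, ENNReal.ofReal (Z ω) ∂Q = ∫⁻ t in Ioi (0 : ℝ), Q {ω | t < Z ω} := by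
    intro Q Z hZ
    have h := lintegral_eq_lintegral_meas_lt Q (f := fun ω => max (Z ω) 0)
      (Filter.Eventually.of_forall fun ω => le_max_right _ _) (hZ.max measurable_const).aemeasurable
    simp only [ENNReal.ofReal_max, ENNReal.ofReal_zero, zero_le, max_eq_left] at h
    rw [h]
    refine setLIntegral_congr_fun measurableSet_Ioi fun t ht => ?_
    have : ¬ t < 0 := not_lt.2 (le_of_lt ht)
    simp [this]
  have hY' : Measurable fun ω => ENNReal.ofReal (Y ω) := hY.ennreal_ofReal
  have h1 : ∫⁻ ω, ENNReal.ofReal (X ω) * ENNReal.ofReal (Y ω) ∂P =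
      ∫⁻ ω, ENNReal.ofReal (X ω) ∂(P.withDensity fun ω => ENNReal.ofReal (Y ω)) := by
    rw [lintegral_withDensity_eq_lintegral_mul _ hY' hX.ennreal_ofReal]
    simp [mul_comm]
  rw [h1, pos _ hX]
  refine setLIntegral_congr_fun measurableSet_Ioi fun s _ => ?_
  have hs : MeasurableSet {ω | s < X ω} := measurableSet_lt measurable_const hX
  rw [withDensity_apply _ hs, pos _ hY]
  refine setLIntegral_congr_fun measurableSet_Ioi fun t _ => ?_
  rw [Measure.restrict_apply (measurableSet_lt measurable_const hY)]
  congr 1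
  ext ω
  exact and_comm

theorem lintegral_ofReal_mul_ofReal [SFinite P] {X Y : Ω → ℝ} (hX : AEMeasurable X P)
    (hY : AEMeasurable Y P) :
    ∫⁻ ω, ENNReal.ofReal (X ω) * ENNReal.ofReal (Y ω) ∂P =
      ∫⁻ s in Ioi (0 : ℝ), ∫⁻ t in Ioi (0 : ℝ), P {ω | s < X ω ∧ t < Y ω} := by
  have h : (fun ω => ENNReal.ofReal (X ω) * ENNReal.ofReal (Y ω)) =ᵐ[P]
      fun ω => ENNReal.ofReal (hX.mk X ω) * ENNReal.ofReal (hY.mk Y ω) := by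
    filter_upwards [hX.ae_eq_mk, hY.ae_eq_mk] with ω h1 h2
    rw [← h1, ← h2]
  rw [lintegral_congr_ae h,
    lintegral_ofReal_mul_ofReal_of_measurable hX.measurable_mk hY.measurable_mk]
  refine lintegral_congr fun s => lintegral_congr fun t => measure_congr ?_
  filter_upwards [hX.ae_eq_mk, hY.ae_eq_mk] with ω h1 h2
  change (s < hX.mk X ω ∧ t < hY.mk Y ω) = (s < X ω ∧ t < Y ω)
  rw [← h1, ← h2]

/-- Two random variables are comonotone if they are similarly ordered on an almost sure set. -/
def Comonotone (P : Measure Ω) (A B : Ω → ℝ) : Prop :=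
  ∃ E : Set Ω, (∀ᵐ ω ∂P, ω ∈ E) ∧ MonovaryOn A B E

theorem Comonotone.symm {A B : Ω → ℝ} (h : Comonotone P A B) : Comonotone P B A := by
  obtain ⟨E, hE, h⟩ := h
  exact ⟨E, hE, h.symm⟩

theorem Comonotone.neg {A B : Ω → ℝ} (h : Comonotone P A B) :
    Comonotone P (fun ω => -A ω) (fun ω => -B ω) := by
  obtain ⟨E, hE, h⟩ := h
  exact ⟨E, hE, fun i hi j hj hij => neg_le_neg (h hj hi (neg_lt_neg_iff.1 hij))⟩

/-- The events `{s < A}` and `{t < B}` are nested up to a null set, so their intersection has the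
smaller of the two marginal probabilities, which no coupling can exceed. -/
theorem Comonotone.measure_le {A B : Ω → ℝ} (h : Comonotone P A B) {X Y : Ω → ℝ}
    (hX : IdentDistrib X A P P) (hY : IdentDistrib Y B P P) (s t : ℝ) :
    P {ω | s < X ω ∧ t < Y ω} ≤ P {ω | s < A ω ∧ t < B ω} := by
  obtain ⟨E, hE, h⟩ := h
  by_cases hsub : ∀ ω ∈ E, s < A ω → t < B ω
  · calc P {ω | s < X ω ∧ t < Y ω} ≤ P {ω | s < X ω} := measure_mono fun ω hω => hω.1
      _ = P {ω | s < A ω} := hX.measure_mem_eq (s := Ioi s) measurableSet_Ioi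
      _ ≤ P {ω | s < A ω ∧ t < B ω} := by
        refine measure_mono_ae ?_
        filter_upwards [hE] with ω hω hs
        exact ⟨hs, hsub ω hω hs⟩
  · push Not at hsub
    obtain ⟨ω₀, hω₀, hs₀, ht₀⟩ := hsub
    calc P {ω | s < X ω ∧ t < Y ω} ≤ P {ω | t < Y ω} := measure_mono fun ω hω => hω.2
      _ = P {ω | t < B ω} := hY.measure_mem_eq (s := Ioi t) measurableSet_Ioi
      _ ≤ P {ω | s < A ω ∧ t < B ω} := by
        refine measure_mono_ae ?_
        filter_upwards [hE] with ω hω ht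
        exact ⟨hs₀.trans_le (h hω₀ hω (ht₀.trans_lt ht)), ht⟩

/-- If `{s < A}` and `{t < -B}` meet on the good set `E`, they must cover it. The intersection then
has the least probability that inclusion-exclusion permits; otherwise it is null. -/
theorem Comonotone.le_measure [IsProbabilityMeasure P] {A B : Ω → ℝ} (h : Comonotone P A B)
    {X Y : Ω → ℝ} (hX : IdentDistrib X A P P) (hY : IdentDistrib Y B P P) (s t : ℝ) :
    P {ω | s < A ω ∧ t < -B ω} ≤ P {ω | s < X ω ∧ t < -Y ω} := by
  obtain ⟨E, hE, h⟩ := h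
  by_cases hdisj : ∀ ω ∈ E, ¬ (s < A ω ∧ t < -B ω)
  · have : P {ω | s < A ω ∧ t < -B ω} = 0 := by
      exact measure_mono_null (t := Eᶜ) (fun ω hω hωE => hdisj ω hωE hω) (mem_ae_iff.1 hE)
    simp [this]
  · push Not at hdisj
    obtain ⟨ω₀, hω₀, hs₀, ht₀⟩ := hdisj
    have add : ∀ {Z W : Ω → ℝ}, AEMeasurable W P →
        P ({ω | s < Z ω} ∪ {ω | t < -W ω}) + P {ω | s < Z ω ∧ t < -W ω} =
          P {ω | s < Z ω} + P {ω | t < -W ω} := by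
      intro Z W hW
      refine measure_union_add_inter₀ _ ?_
      exact nullMeasurableSet_lt aemeasurable_const hW.neg
    have hone : P ({ω | s < A ω} ∪ {ω | t < -B ω}) = 1 := by
      refine (prob_compl_eq_zero_iff₀ ?_).1 ?_
      · exact (nullMeasurableSet_lt aemeasurable_const hX.aemeasurable_snd).union
          (nullMeasurableSet_lt aemeasurable_const hY.aemeasurable_snd.neg)
      · refine measure_mono_null (t := Eᶜ) (fun ω hω hωE => ?_) (mem_ae_iff.1 hE)
        simp only [mem_compl_iff, mem_union, mem_ofPred_eq, not_or, not_lt] at hω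
        have := h hω₀ hωE (by linarith [hω.2])
        linarith [hω.1]
    have e1 : P {ω | s < X ω} = P {ω | s < A ω} :=
      hX.measure_mem_eq (s := Ioi s) measurableSet_Ioi
    have e2 : P {ω | t < -Y ω} = P {ω | t < -B ω} :=
      hY.measure_mem_eq (s := {y | t < -y}) (measurableSet_lt measurable_const measurable_neg)
    have h1 := add (Z := A) hY.aemeasurable_snd
    have h2 := add (Z := X) hY.aemeasurable_fst
    rw [hone] at h1
    rw [e1, e2, ← h1] at h2
    have h3 : 1 + P {ω | s < A ω ∧ t < -B ω} ≤ 1 + P {ω | s < X ω ∧ t < -Y ω} := by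
      rw [← h2]
      gcongr
      exact prob_le_one
    exact (ENNReal.add_le_add_iff_left ENNReal.one_ne_top).1 h3

theorem ofReal_mul_eq_add (x y : ℝ) : ENNReal.ofReal (x * y) =
    ENNReal.ofReal x * ENNReal.ofReal y + ENNReal.ofReal (-x) * ENNReal.ofReal (-y) := by
  rcases le_total 0 x with hx | hx
  · rw [ENNReal.ofReal_mul hx, ENNReal.ofReal_of_nonpos (neg_nonpos.2 hx)]
    simp
  · rw [← neg_mul_neg, ENNReal.ofReal_mul (neg_nonneg.2 hx), ENNReal.ofReal_of_nonpos hx]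
    simp

theorem ofReal_neg_mul_eq_add (x y : ℝ) : ENNReal.ofReal (-(x * y)) =
    ENNReal.ofReal x * ENNReal.ofReal (-y) + ENNReal.ofReal (-x) * ENNReal.ofReal y := by
  rw [neg_mul_eq_mul_neg, ofReal_mul_eq_add, neg_neg]

variable [IsProbabilityMeasure P] {A B X Y : Ω → ℝ}

theorem Comonotone.lintegral_ofReal_le (h : Comonotone P A B)
    (hX : IdentDistrib X A P P) (hY : IdentDistrib Y B P P) :
    ∫⁻ ω, ENNReal.ofReal (X ω * Y ω) ∂P ≤ ∫⁻ ω, ENNReal.ofReal (A ω * B ω) ∂P := by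
  have hX1 := hX.aemeasurable_fst
  have hX2 := hX.aemeasurable_snd
  have hY1 := hY.aemeasurable_fst
  have hY2 := hY.aemeasurable_snd
  simp_rw [ofReal_mul_eq_add]
  rw [lintegral_add_left' (by fun_prop), lintegral_add_left' (by fun_prop),
    lintegral_ofReal_mul_ofReal hX1 hY1,
    lintegral_ofReal_mul_ofReal (X := fun ω => -X ω) (Y := fun ω => -Y ω) hX1.neg hY1.neg,
    lintegral_ofReal_mul_ofReal hX2 hY2,
    lintegral_ofReal_mul_ofReal (X := fun ω => -A ω) (Y := fun ω => -B ω) hX2.neg hY2.neg]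
  refine add_le_add (lintegral_mono fun s => lintegral_mono fun t => ?_)
    (lintegral_mono fun s => lintegral_mono fun t => ?_)
  · exact h.measure_le hX hY _ _
  · exact h.neg.measure_le (hX.comp measurable_neg) (hY.comp measurable_neg) _ _

theorem Comonotone.le_lintegral_ofReal_neg (h : Comonotone P A B)
    (hX : IdentDistrib X A P P) (hY : IdentDistrib Y B P P) :
    ∫⁻ ω, ENNReal.ofReal (-(A ω * B ω)) ∂P ≤ ∫⁻ ω, ENNReal.ofReal (-(X ω * Y ω)) ∂P := by
  have hX1 := hX.aemeasurable_fst
  have hX2 := hX.aemeasurable_snd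
  have hY1 := hY.aemeasurable_fst
  have hY2 := hY.aemeasurable_snd
  simp_rw [ofReal_neg_mul_eq_add]
  rw [lintegral_add_left' (by fun_prop), lintegral_add_left' (by fun_prop),
    lintegral_ofReal_mul_ofReal (Y := fun ω => -Y ω) hX1 hY1.neg,
    lintegral_ofReal_mul_ofReal (X := fun ω => -X ω) hX1.neg hY1,
    lintegral_ofReal_mul_ofReal (Y := fun ω => -B ω) hX2 hY2.neg,
    lintegral_ofReal_mul_ofReal (X := fun ω => -A ω) hX2.neg hY2]
  refine add_le_add (lintegral_mono fun s => lintegral_mono fun t => ?_)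
    (lintegral_mono fun s => lintegral_mono fun t => ?_)
  · exact h.le_measure hX hY _ _
  · simpa [and_comm] using h.symm.le_measure hY hX t s

theorem Comonotone.integrable_posPart (h : Comonotone P A B)
    (hX : IdentDistrib X A P P) (hY : IdentDistrib Y B P P)
    (hAB : Integrable (fun ω => A ω * B ω) P) :
    Integrable (fun ω => max (X ω * Y ω) 0) P := by
  have hX1 := hX.aemeasurable_fst
  have hY1 := hY.aemeasurable_fst
  refine ⟨((hX1.mul hY1).max aemeasurable_const).aestronglyMeasurable, ?_⟩
  rw [hasFiniteIntegral_iff_ofReal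
    (Filter.Eventually.of_forall fun ω => le_max_right (X ω * Y ω) 0)]
  simp only [ENNReal.ofReal_max, ENNReal.ofReal_zero, zero_le, max_eq_left]
  refine (h.lintegral_ofReal_le hX hY).trans_lt ?_
  exact hAB.lintegral_lt_top

theorem Comonotone.integral_le (h : Comonotone P A B)
    (hX : IdentDistrib X A P P) (hY : IdentDistrib Y B P P)
    (hAB : Integrable (fun ω => A ω * B ω) P) (hXY : Integrable (fun ω => X ω * Y ω) P) :
    ∫ ω, X ω * Y ω ∂P ≤ ∫ ω, A ω * B ω ∂P := by
  rw [integral_eq_lintegral_pos_part_sub_lintegral_neg_part hXY,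
    integral_eq_lintegral_pos_part_sub_lintegral_neg_part hAB]
  exact sub_le_sub (ENNReal.toReal_mono hAB.lintegral_lt_top.ne (h.lintegral_ofReal_le hX hY))
    (ENNReal.toReal_mono hXY.neg.lintegral_lt_top.ne (h.le_lintegral_ofReal_neg hX hY))

/-- The pair `A, B` controls the positive part of `XY`. Since `X, Y` is comonotone too, the roles
can be exchanged to control the negative part. -/
theorem Comonotone.integrable (h : Comonotone P A B) (h' : Comonotone P X Y)
    (hX : IdentDistrib X A P P) (hY : IdentDistrib Y B P P)
    (hAB : Integrable (fun ω => A ω * B ω) P) : Integrable (fun ω => X ω * Y ω) P := by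
  have hX1 := hX.aemeasurable_fst
  have hY1 := hY.aemeasurable_fst
  refine ⟨(hX1.mul hY1).aestronglyMeasurable, ?_⟩
  have key : ∀ x : ℝ, ‖x‖ₑ = ENNReal.ofReal x + ENNReal.ofReal (-x) := by
    intro x
    rcases le_total 0 x with hx | hx
    · rw [ENNReal.ofReal_of_nonpos (neg_nonpos.2 hx), add_zero, Real.enorm_of_nonneg hx]
    · rw [ENNReal.ofReal_of_nonpos hx, zero_add, ← enorm_neg,
        Real.enorm_of_nonneg (neg_nonneg.2 hx)]
  simp only [HasFiniteIntegral, key]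
  rw [lintegral_add_left' (by fun_prop)]
  exact ENNReal.add_lt_top.2 ⟨(h.lintegral_ofReal_le hX hY).trans_lt hAB.lintegral_lt_top,
    (h'.le_lintegral_ofReal_neg hX.symm hY.symm).trans_lt hAB.neg.lintegral_lt_top⟩

theorem Comonotone.integral_eq (h : Comonotone P A B) (h' : Comonotone P X Y)
    (hX : IdentDistrib X A P P) (hY : IdentDistrib Y B P P)
    (hAB : Integrable (fun ω => A ω * B ω) P) :
    ∫ ω, X ω * Y ω ∂P = ∫ ω, A ω * B ω ∂P :=
  have hXY := h.integrable h' hX hY hAB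
  le_antisymm (h.integral_le hX hY hAB hXY) (h'.integral_le hX.symm hY.symm hXY hAB)

end Comonotone

/-! ### Quantile functions and the uniform law -/

section Quantile

open Filter Topology

variable (μ : Measure ℝ)

/-- Right-continuity makes the infimum attained. For `p` in `(0,1)` the set is nonempty and bounded
below, so `sInf` takes no default value. -/
theorem quantile_le_iff {p : ℝ} (hp : p ∈ Ioo (0 : ℝ) 1) (x : ℝ) :
    quantile μ p ≤ x ↔ p ≤ cdf μ x := by
  have hne : {x : ℝ | p ≤ cdf μ x}.Nonempty :=
    ((tendsto_cdf_atTop μ).eventually (eventually_ge_nhds hp.2)).exists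
  have hbdd : BddBelow {x : ℝ | p ≤ cdf μ x} := by
    obtain ⟨a, ha⟩ := ((tendsto_cdf_atBot μ).eventually (eventually_lt_nhds hp.1)).exists
    exact ⟨a, fun y hy => (monotone_cdf μ).reflect_lt (ha.trans_le hy) |>.le⟩
  refine ⟨fun h => ?_, fun h => csInf_le hbdd h⟩
  refine le_trans ?_ (monotone_cdf μ h)
  have hc : Tendsto (cdf μ) (𝓝[>] quantile μ p) (𝓝 (cdf μ (quantile μ p))) :=
    ((cdf μ).right_continuous _).mono Ioi_subset_Ici_self
  refine ge_of_tendsto hc ?_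
  filter_upwards [self_mem_nhdsWithin] with y hy
  obtain ⟨z, hz, hzy⟩ := exists_lt_of_csInf_lt hne hy
  exact le_trans hz (monotone_cdf μ hzy.le)

theorem lt_quantile_iff {p : ℝ} (hp : p ∈ Ioo (0 : ℝ) 1) (x : ℝ) :
    x < quantile μ p ↔ cdf μ x < p := by
  rw [← not_le, quantile_le_iff μ hp, not_le]

theorem le_cdf_quantile {p : ℝ} (hp : p ∈ Ioo (0 : ℝ) 1) : p ≤ cdf μ (quantile μ p) :=
  (quantile_le_iff μ hp _).1 le_rfl

theorem monotoneOn_quantile : MonotoneOn (quantile μ) (Ioo 0 1) := fun _ hp _ hq hpq =>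
  (quantile_le_iff μ hp _).2 (hpq.trans (le_cdf_quantile μ hq))

theorem unif_eq : unif = volume.restrict (Ioo (0 : ℝ) 1) :=
  (Measure.restrict_congr_set Ioo_ae_eq_Icc).symm

instance : IsProbabilityMeasure unif := ⟨by simp [unif]⟩

theorem aemeasurable_quantile : AEMeasurable (quantile μ) unif := by
  rw [unif_eq]
  exact aemeasurable_restrict_of_monotoneOn measurableSet_Ioo (monotoneOn_quantile μ)

theorem hasLaw_quantile [IsProbabilityMeasure μ] : HasLaw (quantile μ) μ unif := by
  refine ⟨aemeasurable_quantile μ, ?_⟩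
  have := Measure.isProbabilityMeasure_map (aemeasurable_quantile μ)
  refine Measure.ext_of_Iic _ _ fun x => ?_
  rw [Measure.map_apply_of_aemeasurable (aemeasurable_quantile μ) measurableSet_Iic]
  have h : quantile μ ⁻¹' Iic x =ᵐ[unif] Iic (cdf μ x) := by
    rw [unif_eq]
    filter_upwards [ae_restrict_mem measurableSet_Ioo] with p hp
    exact propext (quantile_le_iff μ hp x)
  have h0 := cdf_nonneg μ x
  have h1 := cdf_le_one μ x
  have h2 : Iic (cdf μ x) ∩ Icc 0 1 = Icc 0 (cdf μ x) := by
    ext y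
    simp only [mem_inter_iff, mem_Iic, mem_Icc]
    constructor
    · rintro ⟨a, b, c⟩
      exact ⟨b, a⟩
    · rintro ⟨a, b⟩
      exact ⟨b, a, b.trans h1⟩
  rw [measure_congr h, unif, Measure.restrict_apply measurableSet_Iic, h2, Real.volume_Icc,
    sub_zero, ofReal_cdf]

theorem hasLaw_one_sub : HasLaw (fun u : ℝ => 1 - u) unif unif := by
  refine ⟨by fun_prop, ?_⟩
  ext s hs
  have h := (Measure.measurePreserving_sub_left volume (1 : ℝ)).restrict_preimage
    (s := Icc (0 : ℝ) 1) measurableSet_Icc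
  have h2 : (fun u : ℝ => 1 - u) ⁻¹' Icc 0 1 = Icc 0 1 := by
    ext y
    simp only [mem_preimage, mem_Icc]
    constructor <;> rintro ⟨a, b⟩ <;> constructor <;> linarith
  rw [h2] at h
  rw [unif, h.map_eq]

theorem ae_mem_Ioo_of_hasLaw {Ω : Type*} [MeasurableSpace Ω] {P : Measure Ω} {U : Ω → ℝ}
    (hU : HasLaw U unif P) : ∀ᵐ ω ∂P, U ω ∈ Ioo (0 : ℝ) 1 := by
  refine ae_of_ae_map hU.aemeasurable ?_
  rw [hU.map_eq, unif_eq]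
  exact ae_restrict_mem measurableSet_Ioo

end Quantile

/-! ### Lifting a random variable through a measurable map -/

section Coupling

open unitInterval

variable {Ω : Type*} [MeasurableSpace Ω] {P : Measure Ω}

theorem hasLaw_projIcc {V : Ω → ℝ} (hV : HasLaw V unif P) :
    HasLaw (fun ω => projIcc (0 : ℝ) 1 zero_le_one (V ω)) (volume : Measure I) P := by
  have hm : Measurable (projIcc (0 : ℝ) 1 zero_le_one) := continuous_projIcc.measurable
  refine ⟨hm.comp_aemeasurable hV.aemeasurable, ?_⟩
  have h : P.map (fun ω => projIcc (0 : ℝ) 1 zero_le_one (V ω)) =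
      unif.map (projIcc (0 : ℝ) 1 zero_le_one) := by
    rw [← hV.map_eq, AEMeasurable.map_map_of_aemeasurable hm.aemeasurable hV.aemeasurable]
    rfl
  rw [h, unif, ← map_comap_subtype_coe measurableSet_Icc, Measure.map_map hm measurable_subtype_coe]
  have h2 : projIcc (0 : ℝ) 1 zero_le_one ∘ (Subtype.val : Icc (0 : ℝ) 1 → ℝ) = id := by
    ext x
    simp
  rw [h2, Measure.map_id]
  rfl

/-- A random variable with the law of `φ(X)` and an independent uniform one give a copy of `X`
over it. -/
theorem exists_hasLaw_comp_ae_eq [IsProbabilityMeasure P] (μ : Measure ℝ) [IsProbabilityMeasure μ]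
    {φ : ℝ → ℝ} (hφ : Measurable φ) {W V : Ω → ℝ} (hW : HasLaw W (μ.map φ) P)
    (hV : HasLaw V unif P) (hWV : IndepFun W V P) :
    ∃ X : Ω → ℝ, HasLaw X μ P ∧ (fun ω => φ (X ω)) =ᵐ[P] W := by
  -- `h x` pushes the uniform law to the conditional law of a `μ`-distributed variable given that
  -- its image under `φ` is `x`; `V` supplies the uniform input.
  obtain ⟨h, hh, hmap⟩ := Kernel.exists_measurable_map_eq_unitInterval (condDistrib id φ μ)
  have hT : Measurable (projIcc (0 : ℝ) 1 zero_le_one) := continuous_projIcc.measurable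
  have hpair : HasLaw (fun ω => (W ω, projIcc (0 : ℝ) 1 zero_le_one (V ω)))
      ((μ.map φ).prod (volume : Measure I)) P := by
    have hV' := hasLaw_projIcc hV
    refine ⟨hW.aemeasurable.prodMk hV'.aemeasurable, ?_⟩
    have hind : IndepFun W (fun ω => projIcc (0 : ℝ) 1 zero_le_one (V ω)) P :=
      hWV.comp measurable_id hT
    rw [hind.map_prod_eq_prod_map_map hW.aemeasurable hV'.aemeasurable, hW.map_eq, hV'.map_eq]
  have hprob : IsProbabilityMeasure (μ.map φ) := Measure.isProbabilityMeasure_map hφ.aemeasurable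
  have hS : HasLaw (fun z : ℝ × I => (z.1, h z.1 z.2)) (μ.map fun x => (φ x, x))
      ((μ.map φ).prod (volume : Measure I)) := by
    have hm : Measurable fun z : ℝ × I => (z.1, h z.1 z.2) := measurable_fst.prodMk hh
    refine ⟨hm.aemeasurable, ?_⟩
    have hc : (μ.map φ) ⊗ₘ condDistrib id φ μ = μ.map fun x => (φ x, x) :=
      compProd_map_condDistrib aemeasurable_id
    rw [← hc]
    ext s hs
    rw [Measure.map_apply hm hs, Measure.prod_apply (hm hs), Measure.compProd_apply hs]
    refine lintegral_congr fun x => ?_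
    have hx : Measurable (h x) := hh.comp measurable_prodMk_left
    rw [← hmap x, Measure.map_apply hx (measurable_prodMk_left hs)]
    rfl
  have hpairs := hS.fun_comp hpair
  refine ⟨fun ω => h (W ω) (projIcc (0 : ℝ) 1 zero_le_one (V ω)), ?_, ?_⟩
  · have hsnd : HasLaw (Prod.snd : ℝ × ℝ → ℝ) μ (μ.map fun x => (φ x, x)) := by
      refine ⟨measurable_snd.aemeasurable, ?_⟩
      rw [Measure.map_map measurable_snd (hφ.prodMk measurable_id')]
      exact Measure.map_id
    exact hsnd.fun_comp hpairs
  · have hset : MeasurableSet {z : ℝ × ℝ | φ z.2 = z.1} :=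
      measurableSet_eq_fun (hφ.comp measurable_snd) measurable_fst
    have hae : ∀ᵐ z ∂(μ.map fun x => (φ x, x)), φ z.2 = z.1 :=
      (ae_map_iff (hφ.prodMk measurable_id).aemeasurable hset).2
        (Filter.Eventually.of_forall fun x => rfl)
    rw [← hpairs.map_eq] at hae
    exact ae_of_ae_map hpairs.aemeasurable hae

end Coupling

/-! ### The inverse branches of `g` and `f` -/

section Branches

open Filter Topology

variable {μ : Measure ℝ}

/-- `g` is the identity minus an antitone function, hence expands distances. Its inverse is strictly
increasing and 1-Lipschitz where defined. -/
theorem sub_le_g_sub {x y : ℝ} (hx : x ∈ Ioo (0 : ℝ) 1) (hy : y ∈ Ioo (0 : ℝ) 1) (hxy : x ≤ y) :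
    y - x ≤ g μ y - g μ x := by
  have := monotone_cdf μ (neg_le_neg (monotoneOn_quantile μ hx hy hxy))
  simp only [g]
  linarith

theorem sub_le_f_sub {x y : ℝ} (hx : x ∈ Ioo (0 : ℝ) 1) (hy : y ∈ Ioo (0 : ℝ) 1) (hxy : x ≤ y) :
    y - x ≤ f μ x - f μ y := by
  have := sub_le_g_sub (μ := μ) hx hy hxy
  simp only [f]
  linarith

theorem gInv_mem {u : ℝ} (hu : u ∈ g μ '' Ioo 0 1) : gInv μ u ∈ Ioo (0 : ℝ) 1 :=
  Function.invFunOn_mem hu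

theorem g_gInv {u : ℝ} (hu : u ∈ g μ '' Ioo 0 1) : g μ (gInv μ u) = u :=
  Function.invFunOn_eq hu

theorem fInv_mem {u : ℝ} (hu : u ∈ f μ '' Ioo 0 1) : fInv μ u ∈ Ioo (0 : ℝ) 1 :=
  Function.invFunOn_mem hu

theorem f_fInv {u : ℝ} (hu : u ∈ f μ '' Ioo 0 1) : f μ (fInv μ u) = u :=
  Function.invFunOn_eq hu

theorem gInv_lt_gInv {u u' : ℝ} (hu : u ∈ g μ '' Ioo 0 1) (hu' : u' ∈ g μ '' Ioo 0 1)
    (h : u < u') : gInv μ u < gInv μ u' := by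
  by_contra! hle
  have := sub_le_g_sub (μ := μ) (gInv_mem hu') (gInv_mem hu) hle
  rw [g_gInv hu, g_gInv hu'] at this
  linarith

theorem gInv_sub_le {u u' : ℝ} (hu : u ∈ g μ '' Ioo 0 1) (hu' : u' ∈ g μ '' Ioo 0 1)
    (h : u < u') : gInv μ u' - gInv μ u ≤ u' - u := by
  have := sub_le_g_sub (μ := μ) (gInv_mem hu) (gInv_mem hu') (gInv_lt_gInv hu hu' h).le
  rwa [g_gInv hu, g_gInv hu'] at this

theorem fInv_lt_fInv {u u' : ℝ} (hu : u ∈ f μ '' Ioo 0 1) (hu' : u' ∈ f μ '' Ioo 0 1)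
    (h : u < u') : fInv μ u' < fInv μ u := by
  by_contra! hle
  have := sub_le_f_sub (μ := μ) (fInv_mem hu) (fInv_mem hu') hle
  rw [f_fInv hu, f_fInv hu'] at this
  linarith

theorem fInv_sub_le {u u' : ℝ} (hu : u ∈ f μ '' Ioo 0 1) (hu' : u' ∈ f μ '' Ioo 0 1)
    (h : u < u') : fInv μ u - fInv μ u' ≤ u' - u := by
  have := sub_le_f_sub (μ := μ) (fInv_mem hu') (fInv_mem hu) (fInv_lt_fInv hu hu' h).le
  rwa [f_fInv hu, f_fInv hu'] at this

theorem cdf_neg_quantile_gInv {u : ℝ} (hu : u ∈ g μ '' Ioo 0 1) :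
    cdf μ (-quantile μ (gInv μ u)) = gInv μ u - u := by
  have h : gInv μ u - cdf μ (-quantile μ (gInv μ u)) = u := g_gInv hu
  linarith

theorem cdf_neg_quantile_fInv {u : ℝ} (hu : u ∈ f μ '' Ioo 0 1) :
    cdf μ (-quantile μ (fInv μ u)) = u + fInv μ u := by
  have h : -(fInv μ u - cdf μ (-quantile μ (fInv μ u))) = u := f_fInv hu
  linarith

/-- Put `v = g⁻¹(u)`, `w = f⁻¹(u)` and let `q` be the quantile function. Then `F(-q(v)) = v - u` and
`F(-q(w)) = w + u`, so `w ≤ v - u` iff `q(w) ≤ -q(v)` iff `q(v) ≤ -q(w)` iff `v ≤ w + u`. The two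
opposite inequalities are equivalent, which forces equality. -/
theorem gInv_sub_fInv {u : ℝ} (hg : u ∈ g μ '' Ioo 0 1) (hf : u ∈ f μ '' Ioo 0 1) :
    gInv μ u - fInv μ u = u := by
  have h1 := cdf_neg_quantile_gInv hg
  have h2 := cdf_neg_quantile_fInv hf
  have hv := gInv_mem hg
  have hw := fInv_mem hf
  apply le_antisymm
  · by_contra! h
    have h3 : quantile μ (fInv μ u) ≤ -quantile μ (gInv μ u) :=
      (quantile_le_iff μ hw _).2 (by linarith)
    have h4 : gInv μ u ≤ cdf μ (-quantile μ (fInv μ u)) :=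
      (quantile_le_iff μ hv _).1 (by linarith)
    linarith
  · by_contra! h
    have h3 : -quantile μ (gInv μ u) < quantile μ (fInv μ u) :=
      (lt_quantile_iff μ hw _).2 (by linarith)
    have h4 : cdf μ (-quantile μ (fInv μ u)) < gInv μ u :=
      (lt_quantile_iff μ hv _).1 (by linarith)
    linarith

theorem quantile_gInv_pos {u : ℝ} (hu : 0 < u) (hg : u ∈ g μ '' Ioo 0 1) :
    0 < quantile μ (gInv μ u) := by
  by_contra! h
  have h1 := cdf_neg_quantile_gInv hg
  have h2 := le_cdf_quantile μ (gInv_mem hg)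
  have h3 := monotone_cdf μ (show quantile μ (gInv μ u) ≤ -quantile μ (gInv μ u) by linarith)
  linarith

theorem quantile_gInv_le {u : ℝ} (hg : u ∈ g μ '' Ioo 0 1) (hf : u ∈ f μ '' Ioo 0 1) :
    quantile μ (gInv μ u) ≤ -quantile μ (fInv μ u) := by
  have h1 := cdf_neg_quantile_gInv hg
  have h2 := gInv_sub_fInv hg hf
  have := (quantile_le_iff μ (fInv_mem hf) (-quantile μ (gInv μ u))).2 (by linarith)
  linarith

/-- With `quantile_gInv_le` this interlaces the absolute values on the two branches: both values at
`u` lie below both values at any `u' > u`. -/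
theorem neg_quantile_fInv_le {u u' : ℝ} (hf : u ∈ f μ '' Ioo 0 1) (hg' : u' ∈ g μ '' Ioo 0 1)
    (hf' : u' ∈ f μ '' Ioo 0 1) (h : u < u') :
    -quantile μ (fInv μ u) ≤ quantile μ (gInv μ u') := by
  have h1 := cdf_neg_quantile_gInv hg'
  have h2 := gInv_sub_fInv hg' hf'
  have h3 := fInv_lt_fInv hf hf' h
  have := (lt_quantile_iff μ (fInv_mem hf) (-quantile μ (gInv μ u'))).2 (by linarith)
  linarith

theorem one_le_deriv_g {x : ℝ} (hx : x ∈ Ioo (0 : ℝ) 1) (hd : DifferentiableAt ℝ (g μ) x) :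
    1 ≤ deriv (g μ) x := by
  refine ge_of_tendsto (hasDerivAt_iff_tendsto_slope.1 hd.hasDerivAt) ?_
  filter_upwards [self_mem_nhdsWithin, mem_nhdsWithin_of_mem_nhds (isOpen_Ioo.mem_nhds hx)]
    with y hne hy
  rw [slope_def_field]
  rcases lt_or_gt_of_ne hne with h | h
  · have := sub_le_g_sub (μ := μ) hy hx h.le
    rw [← neg_div_neg_eq, le_div_iff₀ (by linarith)]
    linarith
  · have := sub_le_g_sub (μ := μ) hx hy h.le
    rw [le_div_iff₀ (by linarith)]
    linarith

theorem f_eq_neg_g : f μ = -g μ := rfl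

theorem deriv_f_le {x : ℝ} (hx : x ∈ Ioo (0 : ℝ) 1) (hd : DifferentiableAt ℝ (f μ) x) :
    deriv (f μ) x ≤ -1 := by
  rw [f_eq_neg_g] at hd ⊢
  have h := one_le_deriv_g hx (differentiableAt_neg_iff.1 hd)
  rw [deriv.neg]
  linarith

/-- The conditions of `InverseBranches` at the point `u`. -/
structure Regular (μ : Measure ℝ) (u : ℝ) : Prop where
  mem_g : u ∈ g μ '' Ioo 0 1
  diff_g : DifferentiableAt ℝ (g μ) (gInv μ u)
  mem_f : u ∈ f μ '' Ioo 0 1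
  diff_f : DifferentiableAt ℝ (f μ) (fInv μ u)

theorem InverseBranches.exists_null {c : ℝ} (h : InverseBranches μ c) :
    ∃ T : Set ℝ, MeasurableSet T ∧ volume T = 0 ∧ ∀ u ∈ Ioo 0 c \ T, Regular μ u := by
  have h' := (ae_restrict_iff' measurableSet_Ioo).1 h
  obtain ⟨T, hsub, hT, h0⟩ := exists_measurable_superset_of_null (ae_iff.1 h')
  refine ⟨T, hT, h0, fun u hu => ?_⟩
  have := not_not.1 fun hn => hu.2 (hsub hn)
  obtain ⟨⟨a, b⟩, c, d⟩ := this hu.1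
  exact ⟨a, b, c, d⟩

/-- The derivative is taken within `S` because the branches are controlled only off a null set,
which may be dense. -/
theorem hasDerivWithinAt_of_leftInvOn {φ ψ : ℝ → ℝ} {φ' u : ℝ} {S : Set ℝ} (hu : u ∈ S)
    (hφ : HasDerivAt φ φ' (ψ u)) (hne : φ' ≠ 0) (hψ : ContinuousWithinAt ψ S u)
    (hinv : ∀ y ∈ S, φ (ψ y) = y) : HasDerivWithinAt ψ φ'⁻¹ S u := by
  have h := HasFDerivWithinAt.of_local_left_inverse (t := univ) (s := S) (g := ψ) (a := u)
    (by rw [nhdsWithin_univ]; exact hψ) (hφ.hasFDerivAt_equiv hne).hasFDerivWithinAt hu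
    (by filter_upwards [self_mem_nhdsWithin] with y hy using hinv y hy)
  exact hasFDerivWithinAt_iff_hasDerivWithinAt.1 h |>.congr_deriv (by simp)

theorem continuousOn_of_abs_sub_le {ψ : ℝ → ℝ} {S : Set ℝ}
    (h : ∀ x ∈ S, ∀ y ∈ S, x < y → |ψ y - ψ x| ≤ y - x) : ContinuousOn ψ S := by
  have hL : LipschitzOnWith 1 ψ S := by
    refine LipschitzOnWith.of_dist_le_mul fun x hx y hy => ?_
    rw [Real.dist_eq, Real.dist_eq, NNReal.coe_one, one_mul]
    rcases lt_trichotomy x y with hxy | rfl | hxy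
    · rw [abs_sub_comm, abs_sub_comm x y, abs_of_pos (sub_pos.2 hxy)]
      exact h x hx y hy hxy
    · simp
    · rw [abs_of_pos (sub_pos.2 hxy)]
      exact h y hy x hx hxy
  exact hL.continuousOn

variable {S : Set ℝ}

theorem hasDerivWithinAt_gInv (hS : ∀ u ∈ S, Regular μ u) {u : ℝ} (hu : u ∈ S) :
    HasDerivWithinAt (gInv μ) (deriv (g μ) (gInv μ u))⁻¹ S u := by
  have h1 := one_le_deriv_g (gInv_mem (hS u hu).mem_g) (hS u hu).diff_g
  refine hasDerivWithinAt_of_leftInvOn hu (hS u hu).diff_g.hasDerivAt (by linarith) ?_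
    fun y hy => g_gInv (hS y hy).mem_g
  refine continuousOn_of_abs_sub_le (fun x hx y hy hxy => ?_) u hu
  rw [abs_of_pos (sub_pos.2 (gInv_lt_gInv (hS x hx).mem_g (hS y hy).mem_g hxy))]
  exact gInv_sub_le (hS x hx).mem_g (hS y hy).mem_g hxy

theorem hasDerivWithinAt_fInv (hS : ∀ u ∈ S, Regular μ u) {u : ℝ} (hu : u ∈ S) :
    HasDerivWithinAt (fInv μ) (deriv (f μ) (fInv μ u))⁻¹ S u := by
  have h1 := deriv_f_le (fInv_mem (hS u hu).mem_f) (hS u hu).diff_f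
  refine hasDerivWithinAt_of_leftInvOn hu (hS u hu).diff_f.hasDerivAt (by linarith) ?_
    fun y hy => f_fInv (hS y hy).mem_f
  refine continuousOn_of_abs_sub_le (fun x hx y hy hxy => ?_) u hu
  rw [abs_sub_comm, abs_of_pos (sub_pos.2 (fInv_lt_fInv (hS x hx).mem_f (hS y hy).mem_f hxy))]
  exact fInv_sub_le (hS x hx).mem_f (hS y hy).mem_f hxy

/-- Needed to compare two derivatives taken within the conull set: every one-sided interval keeps
positive measure after the null set is removed. -/
theorem uniqueDiffWithinAt_sdiff_null {T : Set ℝ} (hT : volume T = 0) {c u : ℝ}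
    (hu : u ∈ Ioo 0 c) : UniqueDiffWithinAt ℝ (Ioo 0 c \ T) u := by
  rw [uniqueDiffWithinAt_iff_accPt, accPt_iff_nhds]
  intro N hN
  obtain ⟨b, hb, hsub⟩ := exists_Ico_subset_of_mem_nhds hN ⟨c, hu.2⟩
  have hub : u < min b c := lt_min hb hu.2
  have hpos : volume (Ioo u (min b c) \ T) ≠ 0 := by
    rw [measure_sdiff_null hT, Real.volume_Ioo]
    simpa using hub
  obtain ⟨y, hy, hyT⟩ := nonempty_of_measure_ne_zero hpos
  exact ⟨y, ⟨hsub ⟨hy.1.le, hy.2.trans_le (min_le_left _ _)⟩,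
    ⟨hu.1.trans hy.1, hy.2.trans_le (min_le_right _ _)⟩, hyT⟩, hy.1.ne'⟩

/-- Differentiating `g⁻¹(u) - f⁻¹(u) = u` gives `1/g' - 1/f' = 1` with `f' < 0 < g'`. Hence `|f'| +
|g'| = |f'| |g'|`, and the threshold simplifies to `1/|f'|`. -/
theorem threshold_eq (hS : ∀ u ∈ S, Regular μ u) {u : ℝ} (hu : u ∈ S)
    (hd : UniqueDiffWithinAt ℝ S u) :
    |(deriv (f μ) (fInv μ u))⁻¹| = threshold μ u ∧
      |(deriv (g μ) (gInv μ u))⁻¹| = 1 - threshold μ u := by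
  have h1 := one_le_deriv_g (gInv_mem (hS u hu).mem_g) (hS u hu).diff_g
  have h2 := deriv_f_le (fInv_mem (hS u hu).mem_f) (hS u hu).diff_f
  have h3 := (hasDerivWithinAt_gInv hS hu).sub (hasDerivWithinAt_fInv hS hu)
  have h4 : HasDerivWithinAt (gInv μ - fInv μ) 1 S u :=
    (hasDerivWithinAt_id u S).congr
      (fun y hy => gInv_sub_fInv (hS y hy).mem_g (hS y hy).mem_f)
      (gInv_sub_fInv (hS u hu).mem_g (hS u hu).mem_f)
  have h5 := hd.eq_deriv _ h3 h4
  unfold threshold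
  generalize deriv (g μ) (gInv μ u) = a at *
  generalize deriv (f μ) (fInv μ u) = b at *
  have ha : 0 < a := by linarith
  have hb : b < 0 := by linarith
  rw [abs_inv, abs_inv, abs_of_pos ha, abs_of_neg hb]
  have hab : -b + a ≠ 0 := by linarith
  have hb' := hb.ne
  field_simp at h5
  constructor
  · rw [inv_eq_one_div, div_eq_div_iff (by linarith) hab]
    linarith
  · rw [eq_sub_iff_add_eq, inv_eq_one_div, div_add_div _ _ ha.ne' hab,
      div_eq_one_iff_eq (mul_ne_zero ha.ne' hab)]
    linear_combination -h5

theorem threshold_mem (hS : ∀ u ∈ S, Regular μ u) {u : ℝ} (hu : u ∈ S)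
    (hd : UniqueDiffWithinAt ℝ S u) : threshold μ u ∈ Icc (0 : ℝ) 1 := by
  obtain ⟨h1, h2⟩ := threshold_eq hS hu hd
  have h3 := abs_nonneg (deriv (f μ) (fInv μ u))⁻¹
  have h4 := abs_nonneg (deriv (g μ) (gInv μ u))⁻¹
  constructor <;> linarith

theorem aemeasurable_gInv (hm : MeasurableSet S) (hS : ∀ u ∈ S, Regular μ u) :
    AEMeasurable (gInv μ) (volume.restrict S) :=
  aemeasurable_restrict_of_monotoneOn hm
    (StrictMonoOn.monotoneOn fun x hx y hy h => gInv_lt_gInv (hS x hx).mem_g (hS y hy).mem_g h)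

theorem aemeasurable_fInv (hm : MeasurableSet S) (hS : ∀ u ∈ S, Regular μ u) :
    AEMeasurable (fInv μ) (volume.restrict S) :=
  aemeasurable_restrict_of_antitoneOn hm
    (StrictAntiOn.antitoneOn fun x hx y hy h => fInv_lt_fInv (hS x hx).mem_f (hS y hy).mem_f h)

theorem aemeasurable_threshold (hm : MeasurableSet S) (hS : ∀ u ∈ S, Regular μ u) :
    AEMeasurable (threshold μ) (volume.restrict S) := by
  have h1 := ((measurable_deriv (g μ)).comp_aemeasurable (aemeasurable_gInv hm hS)).abs
  have h2 := ((measurable_deriv (f μ)).comp_aemeasurable (aemeasurable_fInv hm hS)).abs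
  exact h1.div (h2.add h1)

end Branches

/-! ### The random choice of branch is uniform -/

section Mixture

open Filter Topology
open scoped ENNReal

variable {μ : Measure ℝ}

/-- The weights are the Jacobians of the branches, so the left side is the integral over the union
of their images. That union lies in `D` and has the same measure. -/
theorem lintegral_branches {T D : Set ℝ} {c : ℝ} (hT : MeasurableSet T) (hT0 : volume T = 0)
    (hS : ∀ u ∈ Ioo 0 c \ T, Regular μ u) (hD : volume D = ENNReal.ofReal c)
    (hgD : ∀ u ∈ Ioo 0 c \ T, gInv μ u ∈ D) (hfD : ∀ u ∈ Ioo 0 c \ T, fInv μ u ∈ D)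
    {h : ℝ → ℝ≥0∞} (hh : Measurable h) :
    ∫⁻ u in Ioo 0 c, (ENNReal.ofReal (1 - threshold μ u) * h (gInv μ u) +
      ENNReal.ofReal (threshold μ u) * h (fInv μ u)) = ∫⁻ u in D, h u := by
  set S := Ioo 0 c \ T with hSdef
  have hSm : MeasurableSet S := measurableSet_Ioo.diff hT
  have hSu : ∀ u ∈ S, UniqueDiffWithinAt ℝ S u := fun u hu =>
    uniqueDiffWithinAt_sdiff_null hT0 hu.1
  have hSae : S =ᵐ[volume] Ioo 0 c := sdiff_null_ae_eq_self hT0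
  have hdg : ∀ u ∈ S, HasDerivWithinAt (gInv μ) (deriv (g μ) (gInv μ u))⁻¹ S u :=
    fun u hu => hasDerivWithinAt_gInv hS hu
  have hdf : ∀ u ∈ S, HasDerivWithinAt (fInv μ) (deriv (f μ) (fInv μ u))⁻¹ S u :=
    fun u hu => hasDerivWithinAt_fInv hS hu
  have hgi : InjOn (gInv μ) S :=
    StrictMonoOn.injOn fun x hx y hy h => gInv_lt_gInv (hS x hx).mem_g (hS y hy).mem_g h
  have hfi : InjOn (fInv μ) S :=
    StrictAntiOn.injOn fun x hx y hy h => fInv_lt_fInv (hS x hx).mem_f (hS y hy).mem_f h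
  have hgm : MeasurableSet (gInv μ '' S) :=
    hSm.image_of_continuousOn_injOn (fun u hu => (hdg u hu).continuousWithinAt) hgi
  have hfm : MeasurableSet (fInv μ '' S) :=
    hSm.image_of_continuousOn_injOn (fun u hu => (hdf u hu).continuousWithinAt) hfi
  -- `g` is positive on the first image and negative on the second.
  have hdisj : Disjoint (gInv μ '' S) (fInv μ '' S) := by
    rw [Set.disjoint_left]
    rintro _ ⟨x, hx, rfl⟩ ⟨y, hy, hxy⟩
    have h1 := g_gInv (hS x hx).mem_g
    have h2 : -g μ (fInv μ y) = y := f_fInv (hS y hy).mem_f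
    rw [hxy] at h2
    have := hx.1.1
    have := hy.1.1
    linarith
  have hgint : ∀ k : ℝ → ℝ≥0∞, ∫⁻ u in gInv μ '' S, k u =
      ∫⁻ u in S, ENNReal.ofReal (1 - threshold μ u) * k (gInv μ u) := by
    intro k
    rw [lintegral_image_eq_lintegral_abs_deriv_mul hSm hdg hgi]
    refine setLIntegral_congr_fun hSm fun u hu => ?_
    simp only [(threshold_eq hS hu (hSu u hu)).2]
  have hfint : ∀ k : ℝ → ℝ≥0∞, ∫⁻ u in fInv μ '' S, k u =
      ∫⁻ u in S, ENNReal.ofReal (threshold μ u) * k (fInv μ u) := by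
    intro k
    rw [lintegral_image_eq_lintegral_abs_deriv_mul hSm hdf hfi]
    refine setLIntegral_congr_fun hSm fun u hu => ?_
    simp only [(threshold_eq hS hu (hSu u hu)).1]
  have hmeas : ∀ k : ℝ → ℝ≥0∞, Measurable k → AEMeasurable
      (fun u => ENNReal.ofReal (1 - threshold μ u) * k (gInv μ u)) (volume.restrict S) := by
    intro k hk
    exact ((aemeasurable_threshold hSm hS).const_sub 1).ennreal_ofReal.mul
      (hk.comp_aemeasurable (aemeasurable_gInv hSm hS))
  have hunion : ∀ k : ℝ → ℝ≥0∞, Measurable k → ∫⁻ u in gInv μ '' S ∪ fInv μ '' S, k u =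
      ∫⁻ u in S, (ENNReal.ofReal (1 - threshold μ u) * k (gInv μ u) +
        ENNReal.ofReal (threshold μ u) * k (fInv μ u)) := by
    intro k hk
    rw [lintegral_union hfm hdisj, hgint, hfint, lintegral_add_left' (hmeas k hk)]
  have hvol : volume (gInv μ '' S ∪ fInv μ '' S) = ENNReal.ofReal c := by
    -- Taking the integrand 1 measures the union: the two weights sum to 1, so its volume is `c`.
    have h1 := hunion (fun _ => 1) measurable_const
    rw [setLIntegral_one] at h1
    rw [h1]
    calc _ = ∫⁻ _ in S, 1 := by
          refine setLIntegral_congr_fun hSm fun u hu => ?_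
          obtain ⟨h0, h1⟩ := threshold_mem hS hu (hSu u hu)
          simp only [mul_one]
          rw [← ENNReal.ofReal_add (by linarith) h0]
          simp
      _ = ENNReal.ofReal c := by
          rw [setLIntegral_one, measure_congr hSae, Real.volume_Ioo, sub_zero]
  have hsub : gInv μ '' S ∪ fInv μ '' S ⊆ D := by
    rintro _ (⟨u, hu, rfl⟩ | ⟨u, hu, rfl⟩)
    exacts [hgD u hu, hfD u hu]
  have hDae : (gInv μ '' S ∪ fInv μ '' S : Set ℝ) =ᵐ[volume] D :=
    ae_eq_of_subset_of_measure_ge hsub (by rw [hvol, hD]) (hgm.union hfm).nullMeasurableSet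
      (by rw [hD]; exact ENNReal.ofReal_ne_top)
  rw [← setLIntegral_congr hDae, hunion h hh, setLIntegral_congr hSae]

/-- The mixture of the two branches below the level `c`, and `τ` above it. -/
noncomputable def mixture (μ : Measure ℝ) (c : ℝ) (τ : ℝ → ℝ) (z : ℝ × ℝ) : ℝ :=
  if c < z.1 then τ z.1 else if threshold μ z.1 < z.2 then gInv μ z.1 else fInv μ z.1

theorem ae_mem_or_lt {T : Set ℝ} (hT0 : volume T = 0) (c : ℝ) :
    ∀ᵐ u ∂unif, u ∈ Ioo 0 1 ∧ (u ∈ Ioo 0 c \ T ∨ c < u) := by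
  rw [unif_eq]
  have h1 : ∀ᵐ u ∂(volume : Measure ℝ), u ∉ T := measure_eq_zero_iff_ae_notMem.1 hT0
  have h2 : ∀ᵐ u ∂(volume : Measure ℝ), u ≠ c := by simp [ae_iff]
  filter_upwards [ae_restrict_mem measurableSet_Ioo, ae_restrict_of_ae h1, ae_restrict_of_ae h2]
    with u hu hT hc
  refine ⟨hu, ?_⟩
  rcases lt_or_gt_of_ne hc with h | h
  · exact Or.inl ⟨⟨hu.1, h⟩, hT⟩
  · exact Or.inr h

theorem unif_eq_add {c : ℝ} (h0 : 0 ≤ c) (h1 : c ≤ 1) :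
    unif = volume.restrict (Ioo 0 c) + volume.restrict (Ioo c 1) := by
  have h : (Ioc 0 c ∪ Ioo c 1 : Set ℝ) =ᵐ[volume] Icc 0 1 := by
    rcases h1.lt_or_eq with h1 | rfl
    · rw [Ioc_union_Ioo_eq_Ioo h0 h1]
      exact Ioo_ae_eq_Icc
    · simpa using Ioc_ae_eq_Icc
  have hdisj : Disjoint (Ioc 0 c) (Ioo c 1) :=
    Set.disjoint_left.2 fun x hx hx' => not_lt.2 hx.2 hx'.1
  rw [unif, ← Measure.restrict_congr_set h, Measure.restrict_union hdisj measurableSet_Ioo,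
    Measure.restrict_congr_set (Ioo_ae_eq_Ioc (a := (0 : ℝ)) (b := c))]

theorem unif_slice {p a b : ℝ} (hp : p ∈ Icc (0 : ℝ) 1) (B : Set ℝ) :
    unif {v | (if p < v then a else b) ∈ B} =
      ENNReal.ofReal (1 - p) * B.indicator 1 a + ENNReal.ofReal p * B.indicator 1 b := by
  have hIoi : unif (Ioi p) = ENNReal.ofReal (1 - p) := by
    rw [unif, Measure.restrict_apply measurableSet_Ioi, ← Real.volume_Ioc]
    congr 1
    ext v
    simp only [mem_inter_iff, mem_Ioi, mem_Icc, mem_Ioc]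
    exact ⟨fun h => ⟨h.1, h.2.2⟩, fun h => ⟨h.1, hp.1.trans h.1.le, h.2⟩⟩
  have hIic : unif (Iic p) = ENNReal.ofReal p := by
    rw [unif, Measure.restrict_apply measurableSet_Iic, ← sub_zero p, ← Real.volume_Icc, sub_zero]
    congr 1
    ext v
    simp only [mem_inter_iff, mem_Iic, mem_Icc]
    exact ⟨fun h => ⟨h.2.1, h.1⟩, fun h => ⟨h.2, h.1, h.2.trans hp.2⟩⟩
  by_cases ha : a ∈ B <;> by_cases hb : b ∈ B
  · have : {v | (if p < v then a else b) ∈ B} = univ := by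
      ext v
      simp only [mem_ofPred_eq, mem_univ, iff_true]
      split_ifs <;> assumption
    rw [this, measure_univ]
    simp only [ha, hb, indicator_of_mem, Pi.one_apply, mul_one]
    rw [← ENNReal.ofReal_add (by linarith [hp.2]) hp.1]
    simp
  · have : {v | (if p < v then a else b) ∈ B} = Ioi p := by
      ext v
      simp only [mem_ofPred_eq, mem_Ioi]
      split_ifs with h <;> simp [ha, hb, h]
    simp [this, hIoi, ha, hb]
  · have : {v | (if p < v then a else b) ∈ B} = Iic p := by
      ext v
      simp only [mem_ofPred_eq, mem_Iic]
      split_ifs with h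
      · simp [ha, h]
      · simpa [hb] using h
    simp [this, hIic, ha, hb]
  · have : {v | (if p < v then a else b) ∈ B} = ∅ := by
      ext v
      simp only [mem_ofPred_eq, mem_empty_iff_false, iff_false]
      split_ifs <;> assumption
    simp [this, ha, hb]

/-- Integrating out the second coordinate turns the choice of branch into the weights of
`lintegral_branches`, so the part below `c` contributes Lebesgue measure on `D`; `τ` transports the
rest. -/
theorem hasLaw_mixture {T D : Set ℝ} {c : ℝ} {τ : ℝ → ℝ} (hT : MeasurableSet T)
    (hT0 : volume T = 0) (h0 : 0 ≤ c) (h1 : c ≤ 1) (hS : ∀ u ∈ Ioo 0 c \ T, Regular μ u)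
    (hD : volume D = ENNReal.ofReal c) (hgD : ∀ u ∈ Ioo 0 c \ T, gInv μ u ∈ D)
    (hfD : ∀ u ∈ Ioo 0 c \ T, fInv μ u ∈ D) (hτ : Measurable τ)
    (hDτ : volume.restrict D + (volume.restrict (Ioo c 1)).map τ = unif) :
    HasLaw (mixture μ c τ) unif (unif.prod unif) := by
  have hSm : MeasurableSet (Ioo 0 c \ T) := measurableSet_Ioo.diff hT
  have hSu : ∀ u ∈ Ioo 0 c \ T, UniqueDiffWithinAt ℝ (Ioo 0 c \ T) u := fun u hu =>
    uniqueDiffWithinAt_sdiff_null hT0 hu.1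
  have hmg := aemeasurable_gInv hSm hS
  have hmf := aemeasurable_fInv hSm hS
  have hmp := aemeasurable_threshold hSm hS
  -- The branches take arbitrary values off their ranges, so measurable versions replace them.
  set γ := hmg.mk
  set φ := hmf.mk
  set θ := hmp.mk
  have hγ : Measurable γ := hmg.measurable_mk
  have hφ : Measurable φ := hmf.measurable_mk
  have hθ : Measurable θ := hmp.measurable_mk
  have hae : ∀ᵐ u ∂unif, u ∈ Ioo 0 1 ∧ (c < u ∨ (¬ c < u ∧ u ∈ Ioo 0 c \ T ∧ gInv μ u = γ u ∧
      fInv μ u = φ u ∧ threshold μ u = θ u)) := by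
    have h2 : ∀ᵐ u ∂unif, u ∈ Ioo 0 c \ T →
        gInv μ u = γ u ∧ fInv μ u = φ u ∧ threshold μ u = θ u :=
      ae_restrict_of_ae ((ae_restrict_iff' hSm).1
        (hmg.ae_eq_mk.and (hmf.ae_eq_mk.and hmp.ae_eq_mk)))
    filter_upwards [h2, ae_mem_or_lt hT0 c] with u h h'
    exact ⟨h'.1, h'.2.elim (fun hu => Or.inr ⟨not_lt.2 hu.1.2.le, hu, h hu⟩) Or.inl⟩
  let G : ℝ × ℝ → ℝ := fun z => if c < z.1 then τ z.1 else if θ z.1 < z.2 then γ z.1 else φ z.1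
  have hG : Measurable G :=
    Measurable.ite (measurableSet_lt measurable_const measurable_fst) (hτ.comp measurable_fst)
      (Measurable.ite (measurableSet_lt (hθ.comp measurable_fst) measurable_snd)
        (hγ.comp measurable_fst) (hφ.comp measurable_fst))
  have hGae : mixture μ c τ =ᵐ[unif.prod unif] G := by
    have := Measure.quasiMeasurePreserving_fst (μ := unif) (ν := unif) |>.ae hae
    filter_upwards [this] with z hz
    rcases hz.2 with h | ⟨h, -, e1, e2, e3⟩
    · simp [mixture, G, h]
    · simp [mixture, G, h, e1, e2, e3]
  have hlaw : HasLaw G unif (unif.prod unif) := by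
    refine ⟨hG.aemeasurable, ?_⟩
    ext B hB
    have hBi : Measurable (B.indicator (1 : ℝ → ℝ≥0∞)) := measurable_one.indicator hB
    rw [Measure.map_apply hG hB, Measure.prod_apply (hG hB)]
    have hlow : ∫⁻ u in Ioo 0 c, unif (Prod.mk u ⁻¹' (G ⁻¹' B)) = ∫⁻ u in D, B.indicator 1 u := by
      rw [← lintegral_branches hT hT0 hS hD hgD hfD hBi]
      have hSae : Ioo 0 c \ T =ᵐ[volume] Ioo 0 c := sdiff_null_ae_eq_self hT0
      rw [← setLIntegral_congr hSae, ← setLIntegral_congr hSae]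
      refine lintegral_congr_ae ?_
      filter_upwards [ae_restrict_mem hSm, hmg.ae_eq_mk, hmf.ae_eq_mk, hmp.ae_eq_mk]
        with u hu e1 e2 e3
      rw [← unif_slice (threshold_mem hS hu (hSu u hu)) B]
      congr 1
      ext v
      have hcu : ¬ c < u := not_lt.2 hu.1.2.le
      simp only [mem_preimage, G, hcu, if_false, mem_ofPred_eq]
      change (if θ u < v then γ u else φ u) ∈ B ↔ _
      rw [e1, e2, e3]
    have hhigh : ∫⁻ u in Ioo c 1, unif (Prod.mk u ⁻¹' (G ⁻¹' B)) =
        (volume.restrict (Ioo c 1)).map τ B := by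
      rw [← lintegral_indicator_one hB, lintegral_map hBi hτ]
      refine setLIntegral_congr_fun measurableSet_Ioo fun u hu => ?_
      by_cases h : τ u ∈ B
      · have : Prod.mk u ⁻¹' (G ⁻¹' B) = univ := by
          ext v
          simp [G, hu.1, h]
        simp only [this, measure_univ, indicator_of_mem h, Pi.one_apply]
      · have : Prod.mk u ⁻¹' (G ⁻¹' B) = ∅ := by
          ext v
          simp [G, hu.1, h]
        simp only [this, measure_empty, indicator_of_notMem h]
    rw [← hDτ, Measure.add_apply, ← hhigh, ← lintegral_indicator_one hB, ← hlow, hDτ,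
      ← lintegral_add_measure, ← unif_eq_add h0 h1]
  exact hlaw.congr hGae

end Mixture

/-! ### Monotonicity of the absolute value, and the levels -/

section Tails

open Filter Topology

variable {μ : Measure ℝ}

theorem abs_quantile_mixture_le {T : Set ℝ} {c : ℝ} {τ : ℝ → ℝ}
    (hS : ∀ u ∈ Ioo 0 c \ T, Regular μ u)
    (hbound : ∀ u ∈ Ioo 0 c \ T, ∀ u' ∈ Ioo c 1,
      quantile μ (gInv μ u) ≤ |quantile μ (τ u')| ∧ -quantile μ (fInv μ u) ≤ |quantile μ (τ u')|)
    (hτ : MonotoneOn (fun u => |quantile μ (τ u)|) (Ioo c 1)) {z z' : ℝ × ℝ}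
    (hz : z.1 ∈ Ioo 0 1 ∧ (z.1 ∈ Ioo 0 c \ T ∨ c < z.1))
    (hz' : z'.1 ∈ Ioo 0 1 ∧ (z'.1 ∈ Ioo 0 c \ T ∨ c < z'.1)) (h : z.1 < z'.1) :
    |quantile μ (mixture μ c τ z)| ≤ |quantile μ (mixture μ c τ z')| := by
  have hval : ∀ {y : ℝ × ℝ}, y.1 ∈ Ioo 0 c \ T →
      |quantile μ (mixture μ c τ y)| = quantile μ (gInv μ y.1) ∨
        |quantile μ (mixture μ c τ y)| = -quantile μ (fInv μ y.1) := by
    intro y hy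
    have hr := hS _ hy
    have h1 := quantile_gInv_pos hy.1.1 hr.mem_g
    have h2 := quantile_gInv_le hr.mem_g hr.mem_f
    simp only [mixture, not_lt.2 hy.1.2.le, if_false]
    split_ifs
    · exact Or.inl (abs_of_pos h1)
    · exact Or.inr (abs_of_neg (by linarith))
  rcases hz'.2 with hu' | hu'
  · have hu : z.1 ∈ Ioo 0 c \ T := hz.2.resolve_right (not_lt.2 (h.trans hu'.1.2).le)
    have hr := hS _ hu
    have hr' := hS _ hu'
    have h1 := quantile_gInv_le hr.mem_g hr.mem_f
    have h2 := quantile_gInv_le hr'.mem_g hr'.mem_f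
    have h3 := neg_quantile_fInv_le hr.mem_f hr'.mem_g hr'.mem_f h
    rcases hval hu with e | e <;> rcases hval hu' with e' | e' <;> rw [e, e'] <;> linarith
  · have e' : mixture μ c τ z' = τ z'.1 := by simp [mixture, hu']
    rw [e']
    rcases hz.2 with hu | hu
    · obtain ⟨h1, h2⟩ := hbound _ hu _ ⟨hu', hz'.1.2⟩
      rcases hval hu with e | e <;> rw [e] <;> assumption
    · have e : mixture μ c τ z = τ z.1 := by simp [mixture, hu]
      rw [e]
      exact hτ ⟨hu, hz.1.2⟩ ⟨hu', hz'.1.2⟩ h.le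

variable [IsProbabilityMeasure μ]

theorem cdf_le_cdfExt {y : ℝ} {x : EReal} (h : (y : EReal) ≤ x) : cdf μ y ≤ cdfExt μ x := by
  rw [cdf_eq_real]
  exact measureReal_mono fun z (hz : z ≤ y) => (EReal.coe_le_coe_iff.2 hz).trans h

theorem cdfExt_le_cdf {y : ℝ} {x : EReal} (h : x ≤ (y : EReal)) : cdfExt μ x ≤ cdf μ y := by
  rw [cdf_eq_real]
  exact measureReal_mono fun z (hz : (z : EReal) ≤ x) => EReal.coe_le_coe_iff.1 (hz.trans h)

theorem levelI_mem : levelI μ ∈ Icc (0 : ℝ) 1 := ⟨measureReal_nonneg, measureReal_le_one⟩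

theorem levelK_mem : levelK μ ∈ Icc (0 : ℝ) 1 :=
  ⟨sub_nonneg.2 measureReal_le_one, sub_le_self _ measureReal_nonneg⟩

/-- If `F(-q(x)) > 0`, then the left endpoint is at most `-q(x)`. So `q(x)` is at most its negative,
and `x ≤ F(q(x))` cannot exceed the level. -/
theorem cdf_neg_quantile_of_levelI_lt {x : ℝ} (hx : x ∈ Ioo (0 : ℝ) 1) (h : levelI μ < x) :
    cdf μ (-quantile μ x) = 0 := by
  by_contra hne
  have hpos : 0 < cdf μ (-quantile μ x) := lt_of_le_of_ne (cdf_nonneg μ _) (Ne.symm hne)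
  have h1 : lowerEnd μ ≤ ((-quantile μ x : ℝ) : EReal) := sInf_le ⟨_, hpos, rfl⟩
  have h2 : (quantile μ x : EReal) ≤ -lowerEnd μ := by
    rw [EReal.le_neg]
    exact h1
  have := cdf_le_cdfExt (μ := μ) h2
  exact absurd ((le_cdf_quantile μ hx).trans this) (not_le.2 h)

theorem cdf_neg_quantile_of_lt_levelK {x : ℝ} (hx : x ∈ Ioo (0 : ℝ) 1) (h : x < 1 - levelK μ) :
    cdf μ (-quantile μ x) = 1 := by
  by_contra hne
  have hlt : cdf μ (-quantile μ x) < 1 := lt_of_le_of_ne (cdf_le_one μ _) hne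
  -- Right-continuity yields `z` strictly to the right of `-q(x)` with `F(z) < 1`. Strictness
  -- matters: `F(-z) < x` requires `-z < q(x)`.
  have hc : Tendsto (cdf μ) (𝓝[>] (-quantile μ x)) (𝓝 (cdf μ (-quantile μ x))) :=
    ((cdf μ).right_continuous _).mono Ioi_subset_Ici_self
  obtain ⟨z, hz, hz1⟩ := ((hc.eventually (eventually_lt_nhds hlt)).and self_mem_nhdsWithin).exists
  have h1 : (z : EReal) ≤ upperEnd μ := le_sSup ⟨z, hz, rfl⟩
  have h2 : -upperEnd μ ≤ ((-z : ℝ) : EReal) := by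
    rw [EReal.coe_neg, EReal.neg_le_neg_iff]
    exact h1
  have h3 := cdfExt_le_cdf (μ := μ) h2
  have hz2 : -quantile μ x < z := hz1
  have h4 : cdf μ (-z) < x := (lt_quantile_iff μ hx _).1 (by linarith)
  have h5 : 1 - levelK μ = cdfExt μ (-upperEnd μ) := by simp [levelK]
  linarith

end Tails

/-! ### Even powers: law and monotonicity of the explicit `U₂` -/

section EvenCase

variable {μ : Measure ℝ}

theorem evenCaseI_eq : (fun z : ℝ × ℝ => evenCaseI μ z.1 z.2) = mixture μ (levelI μ) id := by
  funext z
  simp only [evenCaseI, mixture, I, J]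
  split_ifs <;> simp

theorem evenCaseK_eq :
    (fun z : ℝ × ℝ => evenCaseK μ z.1 z.2) = mixture μ (levelK μ) fun u => 1 - u := by
  funext z
  simp only [evenCaseK, mixture, K, J]
  split_ifs <;> simp

variable [IsProbabilityMeasure μ]

/-- Above the level `g(x) = x` and `f(x) = -x`, so neither branch at `u` in `(0,c)` lands there. In
the mirrored case `g(x) = x - 1` and `f(x) = 1 - x` below `1 - c`, which excludes that region. -/
theorem gInv_le_levelI {u : ℝ} (hu : u < levelI μ) (hr : Regular μ u) : gInv μ u ≤ levelI μ := by
  by_contra! h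
  have h1 := cdf_neg_quantile_of_levelI_lt (gInv_mem hr.mem_g) h
  have h2 := cdf_neg_quantile_gInv hr.mem_g
  linarith

theorem fInv_le_levelI {u : ℝ} (hu : 0 < u) (hr : Regular μ u) : fInv μ u ≤ levelI μ := by
  by_contra! h
  have h1 := cdf_neg_quantile_of_levelI_lt (fInv_mem hr.mem_f) h
  have h2 := cdf_neg_quantile_fInv hr.mem_f
  linarith [(fInv_mem hr.mem_f).1]

theorem le_gInv_levelK {u : ℝ} (hu : 0 < u) (hr : Regular μ u) :
    1 - levelK μ ≤ gInv μ u := by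
  by_contra! h
  have h1 := cdf_neg_quantile_of_lt_levelK (gInv_mem hr.mem_g) h
  have h2 := cdf_neg_quantile_gInv hr.mem_g
  linarith [(gInv_mem hr.mem_g).2]

theorem le_fInv_levelK {u : ℝ} (hu : u < levelK μ) (hr : Regular μ u) :
    1 - levelK μ ≤ fInv μ u := by
  by_contra! h
  have h1 := cdf_neg_quantile_of_lt_levelK (fInv_mem hr.mem_f) h
  have h2 := cdf_neg_quantile_fInv hr.mem_f
  linarith

theorem quantile_nonneg_of_levelI_lt {u : ℝ} (hu : u ∈ Ioo (levelI μ) 1) : 0 ≤ quantile μ u := by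
  have hu0 : u ∈ Ioo (0 : ℝ) 1 := ⟨levelI_mem.1.trans_lt hu.1, hu.2⟩
  by_contra! h
  have h1 := cdf_neg_quantile_of_levelI_lt hu0 hu.1
  have h2 := le_cdf_quantile μ hu0
  have h3 := monotone_cdf μ (show quantile μ u ≤ -quantile μ u by linarith)
  linarith [hu0.1]

theorem quantile_nonpos_of_lt_levelK {u : ℝ} (hu : u ∈ Ioo 0 (1 - levelK μ)) :
    quantile μ u ≤ 0 := by
  have hu0 : u ∈ Ioo (0 : ℝ) 1 := ⟨hu.1, hu.2.trans_le (sub_le_self _ levelK_mem.1)⟩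
  by_contra! h
  have h1 := cdf_neg_quantile_of_lt_levelK hu0 hu.2
  have h2 := (lt_quantile_iff μ hu0 (-quantile μ u)).1 (by linarith)
  linarith [hu0.2]

theorem hasLaw_evenCaseI (h : InverseBranches μ (levelI μ)) :
    HasLaw (fun z : ℝ × ℝ => evenCaseI μ z.1 z.2) unif (unif.prod unif) := by
  obtain ⟨T, hT, hT0, hS⟩ := h.exists_null
  obtain ⟨h0, h1⟩ := levelI_mem (μ := μ)
  rw [evenCaseI_eq]
  refine hasLaw_mixture (D := Ioc 0 (levelI μ)) hT hT0 h0 h1 hS (by simp)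
    (fun u hu => ⟨(gInv_mem (hS u hu).mem_g).1, gInv_le_levelI hu.1.2 (hS u hu)⟩)
    (fun u hu => ⟨(fInv_mem (hS u hu).mem_f).1, fInv_le_levelI hu.1.1 (hS u hu)⟩) measurable_id ?_
  rw [Measure.map_id, unif_eq_add h0 h1,
    Measure.restrict_congr_set (Ioo_ae_eq_Ioc (a := (0 : ℝ)) (b := levelI μ))]

theorem hasLaw_evenCaseK (h : InverseBranches μ (levelK μ)) :
    HasLaw (fun z : ℝ × ℝ => evenCaseK μ z.1 z.2) unif (unif.prod unif) := by
  obtain ⟨T, hT, hT0, hS⟩ := h.exists_null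
  obtain ⟨h0, h1⟩ := levelK_mem (μ := μ)
  rw [evenCaseK_eq]
  refine hasLaw_mixture (D := Ico (1 - levelK μ) 1) hT hT0 h0 h1 hS (by simp)
    (fun u hu => ⟨le_gInv_levelK hu.1.1 (hS u hu), (gInv_mem (hS u hu).mem_g).2⟩)
    (fun u hu => ⟨le_fInv_levelK hu.1.2 (hS u hu), (fInv_mem (hS u hu).mem_f).2⟩)
    (measurable_const.sub measurable_id) ?_
  -- Reflection carries `(c,1)` onto `(0,1-c)`, the part of the unit interval not filled by the
  -- branches.
  have h2 := (Measure.measurePreserving_sub_left volume (1 : ℝ)).restrict_preimage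
    (s := Ioo 0 (1 - levelK μ)) measurableSet_Ioo
  have h3 : (fun u : ℝ => 1 - u) ⁻¹' Ioo 0 (1 - levelK μ) = Ioo (levelK μ) 1 := by
    simp
  rw [h3] at h2
  rw [h2.map_eq, add_comm, unif_eq_add (c := 1 - levelK μ) (by linarith) (by linarith)]
  congr 1
  exact Measure.restrict_congr_set Ioo_ae_eq_Ico.symm

/-- A function of two uniform variables is essentially monotone in the first one if it is so
between any two points outside a null set. -/
def EssMonotone (ψ : ℝ × ℝ → ℝ) : Prop :=
  ∃ E : Set ℝ, (∀ᵐ u ∂unif, u ∈ E) ∧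
    ∀ z z' : ℝ × ℝ, z.1 ∈ E → z'.1 ∈ E → z.1 < z'.1 → ψ z ≤ ψ z'

theorem essMonotone_evenCaseI (h : InverseBranches μ (levelI μ)) {d : ℕ} (hd : Even d) :
    EssMonotone fun z => quantile μ (evenCaseI μ z.1 z.2) ^ d := by
  obtain ⟨T, hT, hT0, hS⟩ := h.exists_null
  refine ⟨_, ae_mem_or_lt hT0 (levelI μ), fun z z' hz hz' hlt => ?_⟩
  have e : ∀ y : ℝ × ℝ, evenCaseI μ y.1 y.2 = mixture μ (levelI μ) id y :=
    congrFun evenCaseI_eq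
  simp only [e]
  -- An even power depends only on the absolute value.
  rw [← hd.pow_abs, ← hd.pow_abs (quantile μ (mixture μ (levelI μ) id z'))]
  refine pow_le_pow_left₀ (abs_nonneg _) (abs_quantile_mixture_le hS ?_ ?_ hz hz' hlt) d
  · intro u hu u' hu'
    have hu0 : u' ∈ Ioo (0 : ℝ) 1 := ⟨levelI_mem.1.trans_lt hu'.1, hu'.2⟩
    have hf := fInv_mem (hS u hu).mem_f
    rw [id, abs_of_nonneg (quantile_nonneg_of_levelI_lt hu')]
    constructor
    · exact monotoneOn_quantile μ (gInv_mem (hS u hu).mem_g) hu0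
        ((gInv_le_levelI hu.1.2 (hS u hu)).trans hu'.1.le)
    · have h1 := cdf_neg_quantile_of_levelI_lt hu0 hu'.1
      have := (lt_quantile_iff μ hf (-quantile μ u')).2 (h1 ▸ hf.1)
      linarith
  · intro u hu u' hu' huu'
    simp only [id]
    rw [abs_of_nonneg (quantile_nonneg_of_levelI_lt hu),
      abs_of_nonneg (quantile_nonneg_of_levelI_lt hu')]
    exact monotoneOn_quantile μ ⟨levelI_mem.1.trans_lt hu.1, hu.2⟩
      ⟨levelI_mem.1.trans_lt hu'.1, hu'.2⟩ huu'

theorem essMonotone_evenCaseK (h : InverseBranches μ (levelK μ)) {d : ℕ} (hd : Even d) :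
    EssMonotone fun z => quantile μ (evenCaseK μ z.1 z.2) ^ d := by
  obtain ⟨T, hT, hT0, hS⟩ := h.exists_null
  refine ⟨_, ae_mem_or_lt hT0 (levelK μ), fun z z' hz hz' hlt => ?_⟩
  have e : ∀ y : ℝ × ℝ, evenCaseK μ y.1 y.2 = mixture μ (levelK μ) (fun u => 1 - u) y :=
    congrFun evenCaseK_eq
  simp only [e]
  have hmem : ∀ u ∈ Ioo (levelK μ) 1, 1 - u ∈ Ioo 0 (1 - levelK μ) ∧ 1 - u ∈ Ioo (0 : ℝ) 1 :=
    fun u hu => ⟨⟨by linarith [hu.2], by linarith [hu.1]⟩, by linarith [hu.2],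
      by linarith [hu.1, (levelK_mem (μ := μ)).1]⟩
  rw [← hd.pow_abs, ← hd.pow_abs (quantile μ (mixture μ (levelK μ) (fun u => 1 - u) z'))]
  refine pow_le_pow_left₀ (abs_nonneg _) (abs_quantile_mixture_le hS ?_ ?_ hz hz' hlt) d
  · intro u hu u' hu'
    obtain ⟨h1, h2⟩ := hmem u' hu'
    have hg := gInv_mem (hS u hu).mem_g
    rw [abs_of_nonpos (quantile_nonpos_of_lt_levelK h1)]
    constructor
    · rw [quantile_le_iff μ hg, cdf_neg_quantile_of_lt_levelK h2 h1.2]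
      exact hg.2.le
    · exact neg_le_neg (monotoneOn_quantile μ h2 (fInv_mem (hS u hu).mem_f)
        (h1.2.le.trans (le_fInv_levelK hu.1.2 (hS u hu))))
  · intro u hu u' hu' huu'
    obtain ⟨h1, h2⟩ := hmem u hu
    obtain ⟨h1', h2'⟩ := hmem u' hu'
    simp only
    rw [abs_of_nonpos (quantile_nonpos_of_lt_levelK h1),
      abs_of_nonpos (quantile_nonpos_of_lt_levelK h1')]
    exact neg_le_neg (monotoneOn_quantile μ h2' h2 (by linarith))

end EvenCase

/-! ### Bounds and attainment -/

section Bounds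

variable {Ω : Type*} [MeasurableSpace Ω] {P : Measure Ω} {U V : Ω → ℝ}

/-- A strict inequality between values of `α ∘ U` forces one between values of `U`. Points with
equal `U` but different `V` therefore never need comparing. -/
theorem EssMonotone.comonotone (hU : HasLaw U unif P) {α : ℝ → ℝ} (hα : MonotoneOn α (Ioo 0 1))
    {ψ : ℝ × ℝ → ℝ} (hψ : EssMonotone ψ) :
    Comonotone P (fun ω => α (U ω)) (fun ω => ψ (U ω, V ω)) := by
  obtain ⟨E, hE, h⟩ := hψ
  refine Comonotone.symm ⟨{ω | U ω ∈ E ∩ Ioo 0 1}, ?_, fun ω hω ω' hω' hlt => ?_⟩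
  · have h1 : ∀ᵐ ω ∂P, U ω ∈ E := ae_of_ae_map hU.aemeasurable (hU.map_eq.symm ▸ hE)
    filter_upwards [h1, ae_mem_Ioo_of_hasLaw hU] with ω h1 h2 using ⟨h1, h2⟩
  · exact h _ _ hω.1 hω'.1 (hα.reflect_lt hω.2 hω'.2 hlt)

theorem essMonotone_comp_fst {β : ℝ → ℝ} (hβ : MonotoneOn β (Ioo 0 1)) :
    EssMonotone fun z => β z.1 := by
  refine ⟨Ioo 0 1, ?_, fun z z' hz hz' h => hβ hz hz' h.le⟩
  rw [unif_eq]
  exact ae_restrict_mem measurableSet_Ioo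

theorem hasLaw_pow {μ : Measure ℝ} {X : Ω → ℝ} (hX : HasLaw X μ P) (d : ℕ) :
    HasLaw (fun ω => X ω ^ d) (powLaw μ d) P :=
  HasLaw.fun_comp (Y := fun x : ℝ => x ^ d) ⟨by fun_prop, rfl⟩ hX

variable [IsProbabilityMeasure P] {μ₁ μ₂ : Measure ℝ} [IsProbabilityMeasure μ₂]

theorem hasLaw_prodMk (hU : HasLaw U unif P) (hV : HasLaw V unif P) (hUV : IndepFun U V P) :
    HasLaw (fun ω => (U ω, V ω)) (unif.prod unif) P := by
  refine ⟨hU.aemeasurable.prodMk hV.aemeasurable, ?_⟩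
  rw [hUV.map_prod_eq_prod_map_map hU.aemeasurable hV.aemeasurable, hU.map_eq, hV.map_eq]

theorem attains_cases {d : ℕ} {U₁ : Ω → ℝ} {e : ℝ} (hU : HasLaw U unif P)
    (hV : HasLaw V unif P) (hUV : IndepFun U V P)
    (h : ∀ υ : ℝ × ℝ → ℝ, HasLaw (fun ω => υ (U ω, V ω)) unif P →
      EssMonotone (fun z => quantile μ₂ (υ z) ^ d) →
      Attains P μ₁ μ₂ d U₁ (fun ω => υ (U ω, V ω)) e) :
    (Odd d → Attains P μ₁ μ₂ d U₁ U e) ∧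
    (Even d → InverseBranches μ₂ (levelI μ₂) →
      Attains P μ₁ μ₂ d U₁ (fun ω => evenCaseI μ₂ (U ω) (V ω)) e) ∧
    (Even d → InverseBranches μ₂ (levelK μ₂) →
      Attains P μ₁ μ₂ d U₁ (fun ω => evenCaseK μ₂ (U ω) (V ω)) e) := by
  have hpair := hasLaw_prodMk hU hV hUV
  refine ⟨fun hd => h Prod.fst hU (essMonotone_comp_fst (β := fun u => quantile μ₂ u ^ d)
      fun u hu u' hu' huu' => ?_),
    fun hd hI => h (fun z => evenCaseI μ₂ z.1 z.2) ((hasLaw_evenCaseI hI).fun_comp hpair)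
      (essMonotone_evenCaseI hI hd),
    fun hd hK => h (fun z => evenCaseK μ₂ z.1 z.2) ((hasLaw_evenCaseK hK).fun_comp hpair)
      (essMonotone_evenCaseK hK hd)⟩
  exact hd.strictMono_pow.monotone (monotoneOn_quantile μ₂ hu hu' huu')

variable [IsProbabilityMeasure μ₁]

instance (d : ℕ) : IsProbabilityMeasure (powLaw μ₂ d) :=
  Measure.isProbabilityMeasure_map (by fun_prop)

/-- Both bounds at once: `s = 1` with `U₁ = U` gives the maximum, `s = -1` with `U₁ = 1 - U` the
minimum. In each case `s` times the first quantile is an increasing function `α` of `U`. -/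
theorem sharp_bounds (hU : HasLaw U unif P) (hV : HasLaw V unif P) (hUV : IndepFun U V P) (d : ℕ)
    {s : ℝ} (hs : s ≠ 0) {U₁ : Ω → ℝ} (hU₁ : HasLaw U₁ unif P) {α : ℝ → ℝ}
    (hα : MonotoneOn α (Ioo 0 1)) (hαU : ∀ ω, s * quantile μ₁ (U₁ ω) = α (U ω))
    (hint : Integrable (fun ω => quantile μ₁ (U₁ ω) * quantile (powLaw μ₂ d) (U ω)) P) :
    (∀ X₁ X₂ : Ω → ℝ, HasLaw X₁ μ₁ P → HasLaw X₂ μ₂ P →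
      Integrable (fun ω => max (s * (X₁ ω * X₂ ω ^ d)) 0) P) ∧
    (∫ ω, quantile μ₁ (U₁ ω) * quantile (powLaw μ₂ d) (U ω) ∂P ∈ mixedMoments P μ₁ μ₂ d) ∧
    (∀ e ∈ mixedMoments P μ₁ μ₂ d,
      s * e ≤ s * ∫ ω, quantile μ₁ (U₁ ω) * quantile (powLaw μ₂ d) (U ω) ∂P) ∧
    (∀ υ : ℝ × ℝ → ℝ, HasLaw (fun ω => υ (U ω, V ω)) unif P →
      EssMonotone (fun z => quantile μ₂ (υ z) ^ d) →
      Attains P μ₁ μ₂ d U₁ (fun ω => υ (U ω, V ω))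
        (∫ ω, quantile μ₁ (U₁ ω) * quantile (powLaw μ₂ d) (U ω) ∂P)) := by
  have hA : HasLaw (fun ω => quantile μ₁ (U₁ ω)) μ₁ P := (hasLaw_quantile μ₁).fun_comp hU₁
  have hB : HasLaw (fun ω => quantile (powLaw μ₂ d) (U ω)) (powLaw μ₂ d) P :=
    (hasLaw_quantile (powLaw μ₂ d)).fun_comp hU
  have hcom : Comonotone P (fun ω => s * quantile μ₁ (U₁ ω))
      (fun ω => quantile (powLaw μ₂ d) (U ω)) := by
    simp only [hαU]
    exact (essMonotone_comp_fst (monotoneOn_quantile _)).comonotone (V := V) hU hα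
  have hint' : Integrable (fun ω => s * quantile μ₁ (U₁ ω) * quantile (powLaw μ₂ d) (U ω)) P := by
    simpa only [mul_assoc] using hint.const_mul s
  have hid : ∀ {X : Ω → ℝ}, HasLaw X μ₁ P →
      IdentDistrib (fun ω => s * X ω) (fun ω => s * quantile μ₁ (U₁ ω)) P P := fun hX =>
    (hX.identDistrib hA).comp (measurable_const_mul s)
  refine ⟨fun X₁ X₂ h₁ h₂ => ?_, ?_, ?_, fun υ hυ hmono => ?_⟩
  · have := hcom.integrable_posPart (hid h₁) ((hasLaw_pow h₂ d).identDistrib hB) hint'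
    simpa only [mul_assoc] using this
  · have hBV : IndepFun (fun ω => quantile (powLaw μ₂ d) (U ω)) V P :=
      hUV.comp₀ (φ := quantile (powLaw μ₂ d)) (ψ := id) hU.aemeasurable hV.aemeasurable
        (hU.map_eq.symm ▸ aemeasurable_quantile _) aemeasurable_id
    obtain ⟨X₂, hX₂, hae⟩ :=
      exists_hasLaw_comp_ae_eq μ₂ (φ := fun x => x ^ d) (by fun_prop) hB hV hBV
    have hprod : (fun ω => quantile μ₁ (U₁ ω) * quantile (powLaw μ₂ d) (U ω)) =ᵐ[P]
        fun ω => quantile μ₁ (U₁ ω) * X₂ ω ^ d := by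
      filter_upwards [hae] with ω hω
      rw [← hω]
    exact ⟨_, X₂, hA, hX₂, hint.congr hprod, integral_congr_ae hprod⟩
  · rintro e ⟨X₁, X₂, h₁, h₂, hX, rfl⟩
    have := hcom.integral_le (hid h₁) ((hasLaw_pow h₂ d).identDistrib hB) hint'
      (by simpa only [mul_assoc] using hX.const_mul s)
    simpa only [mul_assoc, integral_const_mul] using this
  · have h₂ : HasLaw (fun ω => quantile μ₂ (υ (U ω, V ω))) μ₂ P :=
      (hasLaw_quantile μ₂).fun_comp hυ
    have hcom' : Comonotone P (fun ω => s * quantile μ₁ (U₁ ω))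
        (fun ω => quantile μ₂ (υ (U ω, V ω)) ^ d) := by
      simp only [hαU]
      exact hmono.comonotone hU hα
    have hid₂ := (hasLaw_pow h₂ d).identDistrib hB
    -- The explicit coupling is comonotone with the same marginals, so it inherits integrability and
    -- the mean.
    have h3 := hcom.integrable hcom' (hid hA) hid₂ hint'
    have h4 := hcom.integral_eq hcom' (hid hA) hid₂ hint'
    simp only [mul_assoc, integral_const_mul] at h4
    simp only [mul_assoc] at h3
    exact ⟨hU₁, hυ, hA, h₂, (integrable_const_mul_iff hs.isUnit _).1 h3, mul_left_cancel₀ hs h4⟩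

end Bounds

end SharpBounds

theorem theorem1 {Ω : Type*} [MeasurableSpace Ω] (P : Measure Ω) [IsProbabilityMeasure P]
    (μ₁ μ₂ : Measure ℝ) [IsProbabilityMeasure μ₁] [IsProbabilityMeasure μ₂]
    (d : ℕ) (hd : 0 < d) (U V : Ω → ℝ)
    (hU : HasLaw U SharpBounds.unif P) (hV : HasLaw V SharpBounds.unif P)
    (hUV : IndepFun U V P) :
    -- the upper bound `M` and the couplings that attain it
    (∀ M : ℝ,
      Integrable (fun ω => quantile μ₁ (U ω) * quantile (powLaw μ₂ d) (U ω)) P →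
      M = ∫ ω, quantile μ₁ (U ω) * quantile (powLaw μ₂ d) (U ω) ∂P →
      (∀ X₁ X₂ : Ω → ℝ, HasLaw X₁ μ₁ P → HasLaw X₂ μ₂ P →
        Integrable (fun ω => max (X₁ ω * X₂ ω ^ d) 0) P) ∧
      IsGreatest (mixedMoments P μ₁ μ₂ d) M ∧
      (Odd d → Attains P μ₁ μ₂ d U U M) ∧
      (Even d → lowerEnd μ₂ ≤ 0 → 0 < upperEnd μ₂ → -lowerEnd μ₂ ≤ upperEnd μ₂ →
        InverseBranches μ₂ (levelI μ₂) →
        Attains P μ₁ μ₂ d U (fun ω => evenCaseI μ₂ (U ω) (V ω)) M) ∧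
      (Even d → lowerEnd μ₂ < 0 → 0 ≤ upperEnd μ₂ → upperEnd μ₂ ≤ -lowerEnd μ₂ →
        InverseBranches μ₂ (levelK μ₂) →
        Attains P μ₁ μ₂ d U (fun ω => evenCaseK μ₂ (U ω) (V ω)) M)) ∧
    -- the lower bound `m` and the couplings that attain it
    (∀ m : ℝ,
      Integrable (fun ω => quantile μ₁ (1 - U ω) * quantile (powLaw μ₂ d) (U ω)) P →
      m = ∫ ω, quantile μ₁ (1 - U ω) * quantile (powLaw μ₂ d) (U ω) ∂P →
      (∀ X₁ X₂ : Ω → ℝ, HasLaw X₁ μ₁ P → HasLaw X₂ μ₂ P →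
        Integrable (fun ω => max (-(X₁ ω * X₂ ω ^ d)) 0) P) ∧
      IsLeast (mixedMoments P μ₁ μ₂ d) m ∧
      (Odd d → Attains P μ₁ μ₂ d (fun ω => 1 - U ω) U m) ∧
      (Even d → lowerEnd μ₂ ≤ 0 → 0 < upperEnd μ₂ → -lowerEnd μ₂ ≤ upperEnd μ₂ →
        InverseBranches μ₂ (levelI μ₂) →
        Attains P μ₁ μ₂ d (fun ω => 1 - U ω) (fun ω => evenCaseI μ₂ (U ω) (V ω)) m) ∧
      (Even d → lowerEnd μ₂ < 0 → 0 ≤ upperEnd μ₂ → upperEnd μ₂ ≤ -lowerEnd μ₂ →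
        InverseBranches μ₂ (levelK μ₂) →
        Attains P μ₁ μ₂ d (fun ω => 1 - U ω) (fun ω => evenCaseK μ₂ (U ω) (V ω)) m)) := by
  refine ⟨?_, ?_⟩
  · rintro M hint rfl
    obtain ⟨h1, h2, h3, h4⟩ := sharp_bounds hU hV hUV d one_ne_zero hU (monotoneOn_quantile μ₁)
      (fun ω => one_mul _) hint
    obtain ⟨a1, a2, a3⟩ := attains_cases hU hV hUV h4
    refine ⟨fun X₁ X₂ h h' => by simpa only [one_mul] using h1 X₁ X₂ h h', ⟨h2, fun e he => ?_⟩, a1,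
      fun hd _ _ _ => a2 hd, fun hd _ _ _ => a3 hd⟩
    simpa only [one_mul] using h3 e he
  · rintro m hint rfl
    have hU₁ : HasLaw (fun ω => 1 - U ω) unif P := hasLaw_one_sub.fun_comp hU
    have hα : MonotoneOn (fun u => -quantile μ₁ (1 - u)) (Ioo 0 1) := fun u hu u' hu' h =>
      neg_le_neg (monotoneOn_quantile μ₁ ⟨by linarith [hu'.2], by linarith [hu'.1]⟩
        ⟨by linarith [hu.2], by linarith [hu.1]⟩ (by linarith))
    obtain ⟨h1, h2, h3, h4⟩ := sharp_bounds (s := -1) hU hV hUV d (by norm_num) hU₁ hα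
      (fun ω => neg_one_mul _) hint
    obtain ⟨a1, a2, a3⟩ := attains_cases hU hV hUV h4
    refine ⟨fun X₁ X₂ h h' => by simpa only [neg_one_mul] using h1 X₁ X₂ h h',
      ⟨h2, fun e he => ?_⟩, a1, fun hd _ _ _ => a2 hd, fun hd _ _ _ => a3 hd⟩
    have := h3 e he
    linarith
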